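/- Let $T>0$, $s,m\in\mathbb N$, $n=n_1+\dots+n_s$, and consider the initial value problem $$\tfrac{\mathrm d}{\mathrm dt}Ex(t)=(J-R)Qx(t)+Bu(t),\quad t\in[0,T],\qquad Ex(0)=Ex_0,$$ with $x_0\in\mathbb R^n$ and $u\in L^2([0,T],\mathbb R^m)$, where $E=\operatorname{diag}(E_1,\dots,E_s)$, $R=\operatorname{diag}(R_1,\dots,R_s)$, $Q=\operatorname{diag}(Q_1,\dots,Q_s)$ are real block diagonal $n\times n$ matrices with $n_i\times n_i$ blocks, $B\in\mathbb R^{n\times m}$, and $J=J_d+J_o$, where $J_d=\operatorname{diag}(J_1,\dots,J_s)$ and $J_o$ has zero diagonal blocks, blocks $J_{ij}\in\mathbb R^{n_i\times n_j}$ above the diagonal ($i<j$) and blocks $-J_{ji}^\top$ below it ($i>j$). Assume: (a) for all $i$: $R_i=R_i^\top\ge0$, $J_i^\top=-J_i$, $E_i^\top Q_i=Q_i^\top E_i\ge0$, and $Q_i$ is invertible; (b) $\operatorname{rk}\begin{bmatrix}E&R&J\end{bmatrix}=n$; (c) for matrices $Z$, $Z_1$ with full column rank, $\operatorname{im}Z=\ker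 E$ and $\operatorname{im}Z_1=\ker RQZ\cap\ker Z^\top Q^\top JQZ$, one has $Z_1^\top Z^\top Q^\top Bu\in H^1([0,T])$ and $Z_1^\top Z^\top Q^\top(JQx_0+Bu(0))=0$ (with $Z_1^\top Z^\top Q^\top Bu(0)$ the value at $0$ of this $H^1$ function; the condition does not depend on the choice of $Z,Z_1$). Let $0\le\mu\le\omega$ and $\alpha\in[0,1]$. Let $L^2_\omega([0,T],\mathbb R^n)$ be the real Hilbert space with inner product $\langle f,g\rangle_{2,\omega}=\int_0^Te^{-2t\omega}f(t)^\top g(t)\,dt$ and norm $\|\cdot\|_{2,\omega}$. Define the operator $M$ in $L^2_\omega([0,T],\mathbb R^n)$ by $$D(M)=\{x\in L^2_\omega([0,T],\mathbb R^n)\mid Ex\in H^1([0,T],\mathbb R^n),\ Ex(0)=Ex_0\},$$ $$Mx=\tfrac{\mathrm d}{\mathrm dt}(Ex)-(J_d-\alpha R+\mu EQ^{-1})Qx-Bu,$$ and $MQ^{-1}$ with domain $QD(M)$ by $v\mapsto M(Q^{-1}v)$; $H^1$ functions are evaluated at points through their continuous representatives. Then: 1. $MQ^{-1}$ is maximally monotone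 on $L^2_\omega([0,T],\mathbb R^n)$, i.e. its graph $Y$ satisfies $\langle x-x',y-y'\rangle_{2,\omega}\ge0$ for all $(x,y),(x',y')\in Y$ and is not a proper subset of another set with this property. 2. For all $v,w\in QD(M)$, the function $(EQ^{-1})^{1/2}(v-w)$ has a representative that is continuous on $[0,T]$ and, with the value at $T$ taken from it, $$\begin{aligned}\langle MQ^{-1}v-MQ^{-1}w,\ v-w\rangle_{2,\omega}={}&\tfrac12e^{-2T\omega}\big\|(EQ^{-1})^{1/2}(v(T)-w(T))\big\|^2\\&+(\omega-\mu)\big\|(EQ^{-1})^{1/2}(v-w)\big\|_{2,\omega}^2+\alpha\big\|R^{1/2}(v-w)\big\|_{2,\omega}^2\ \ge\ 0.\end{aligned}$$ 3. $I+\lambda MQ^{-1}:QD(M)\to L^2_\omega([0,T],\mathbb R^n)$ is surjective for every $\lambda>0$. -/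

import Mathlib

open MeasureTheory Set Matrix

noncomputable section

namespace PHDAE

/-! ### Monotone sets and operators -/

section Monotone

variable {X : Type*} [NormedAddCommGroup X] [InnerProductSpace ℝ X]

/-- A monotone subset of `X × X`. -/
def IsMonotoneSet (Y : Set (X × X)) : Prop :=
  ∀ p ∈ Y, ∀ q ∈ Y, 0 ≤ inner ℝ (p.1 - q.1) (p.2 - q.2)

/-- A maximally monotone subset of `X × X`: it is monotone and not a proper subset of a monotone
subset of `X × X`. -/
def IsMaximallyMonotoneSet (Y : Set (X × X)) : Prop :=
  IsMonotoneSet Y ∧ ∀ Y' : Set (X × X), IsMonotoneSet Y' → ¬ Y ⊂ Y'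

/-- A (possibly nonlinear, partially defined) operator `A : D(A) ⊂ X → X` is maximally monotone
if its graph is. -/
def IsMaximallyMonotone (A : X →. X) : Prop := IsMaximallyMonotoneSet A.graph

end Monotone

/-! ### The Sobolev space `H¹([0,T], F)` -/

section Sobolev

variable {F : Type*} [NormedAddCommGroup F] [NormedSpace ℝ F]

/-- `f ∈ H¹([0,T], F)`, with weak derivative `g`: both are square integrable on `[0,T]`, and
`∫ φ' f = - ∫ φ g` for all smooth test functions `φ` with compact support in `(0,T)`. -/
structure HasWeakDeriv (T : ℝ) (f g : ℝ → F) : Prop where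
  memLp : MemLp f 2 (volume.restrict (Icc 0 T))
  memLp_deriv : MemLp g 2 (volume.restrict (Icc 0 T))
  integral_eq : ∀ φ : ℝ → ℝ, ContDiff ℝ (⊤ : ℕ∞) φ → HasCompactSupport φ → tsupport φ ⊆ Ioo 0 T →
    ∫ t in Icc 0 T, deriv φ t • f t = - ∫ t in Icc 0 T, φ t • g t

/-- `f ∈ H¹([0,T], F)`. -/
def MemH1 (T : ℝ) (f : ℝ → F) : Prop := ∃ g, HasWeakDeriv T f g

/-- The weak derivative of `f ∈ H¹([0,T], F)` (unique up to null sets, see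
`HasWeakDeriv.unique`). -/
def MemH1.weakDeriv {T : ℝ} {f : ℝ → F} (hf : MemH1 T f) : ℝ → F := hf.choose

theorem MemH1.hasWeakDeriv {T : ℝ} {f : ℝ → F} (hf : MemH1 T f) :
    HasWeakDeriv T f hf.weakDeriv := hf.choose_spec

/-- Weak derivatives are unique up to null sets. -/
theorem HasWeakDeriv.unique [FiniteDimensional ℝ F] {T : ℝ} {f g h : ℝ → F}
    (hg : HasWeakDeriv T f g) (hh : HasWeakDeriv T f h) :
    g =ᵐ[volume.restrict (Icc 0 T)] h := by
  have ig : IntegrableOn g (Icc 0 T) := hg.memLp_deriv.integrable (by norm_num)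
  have ih : IntegrableOn h (Icc 0 T) := hh.memLp_deriv.integrable (by norm_num)
  have key : ∀ᵐ t, t ∈ Ioo 0 T → (g - h) t = 0 := by
    refine isOpen_Ioo.ae_eq_zero_of_integral_contDiff_smul_eq_zero
      ((ig.sub ih).mono_set Ioo_subset_Icc_self).locallyIntegrableOn ?_
    intro φ hφ hc hs
    have e1 := hg.integral_eq φ hφ hc hs
    have e2 := hh.integral_eq φ hφ hc hs
    have hb : ∀ k : ℝ → F, IntegrableOn k (Icc 0 T) →
        IntegrableOn (fun t => φ t • k t) (Icc 0 T) := by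
      intro k hk
      exact hk.continuousOn_smul hφ.continuous.continuousOn isCompact_Icc
    have e3 : ∫ t in Icc 0 T, φ t • (g - h) t = 0 := by
      simp only [Pi.sub_apply, smul_sub]
      rw [integral_sub (hb g ig) (hb h ih)]
      rw [e1] at e2
      rw [neg_inj.mp e2, sub_self]
    rw [← e3, eq_comm]
    refine setIntegral_eq_integral_of_forall_compl_eq_zero ?_
    intro t ht
    have : φ t = 0 := image_eq_zero_of_notMem_tsupport
      fun h' => ht (Ioo_subset_Icc_self (hs h'))
    simp [this]
  rw [← Measure.restrict_congr_set (Ioo_ae_eq_Icc (a := (0 : ℝ)) (b := T)), Filter.EventuallyEq,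
    ae_restrict_iff' measurableSet_Ioo]
  filter_upwards [key] with t ht hm
  exact sub_eq_zero.mp (ht hm)

/-- `z` is a representative of `f` that is continuous on `[0,T]`. The values of `f` at single
points are those of `z`. -/
def IsContRep (T : ℝ) (f z : ℝ → F) : Prop :=
  ContinuousOn z (Icc 0 T) ∧ z =ᵐ[volume.restrict (Icc 0 T)] f

/-- `f(t₀) = a`, for (the continuous representative of) a function `f` on `[0,T]`. -/
def HasValueAt (T : ℝ) (f : ℝ → F) (t₀ : ℝ) (a : F) : Prop :=
  ∃ z, IsContRep T f z ∧ z t₀ = a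

end Sobolev

/-! ### The weighted space `L²_ω([0,T], ℝ^κ)` -/

/-- The measure `e^{-2tω} dt` on `[0,T]`. -/
def weightedMeasure (T ω : ℝ) : Measure ℝ :=
  (volume.restrict (Icc 0 T)).withDensity fun t => ENNReal.ofReal (Real.exp (-2 * t * ω))

/-- The Hilbert space `L²_ω([0,T], ℝ^κ)`, with inner product
`⟪f, g⟫ = ∫₀ᵀ e^{-2tω} ⟪f t, g t⟫ dt`. -/
abbrev WeightedL2 (T ω : ℝ) (κ : Type*) [Fintype κ] :=
  Lp (EuclideanSpace ℝ κ) 2 (weightedMeasure T ω)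

theorem weightedMeasure_le (T ω : ℝ) :
    weightedMeasure T ω ≤
      ENNReal.ofReal (Real.exp (2 * |ω| * |T|)) • volume.restrict (Icc 0 T) := by
  rw [weightedMeasure, ← withDensity_const]
  refine withDensity_mono ?_
  refine (ae_restrict_iff' measurableSet_Icc).mpr (Filter.Eventually.of_forall fun t ht => ?_)
  refine ENNReal.ofReal_le_ofReal (Real.exp_le_exp.mpr ?_)
  have h1 : -(t * ω) ≤ |t| * |ω| := by
    rw [← abs_mul]; exact neg_le_abs _
  have h2 : |t| ≤ |T| := by
    rw [abs_of_nonneg ht.1]; exact ht.2.trans (le_abs_self T)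
  nlinarith [mul_le_mul_of_nonneg_right h2 (abs_nonneg ω)]

theorem memLp_weighted {F : Type*} [NormedAddCommGroup F] {T : ℝ} (ω : ℝ) {f : ℝ → F}
    (hf : MemLp f 2 (volume.restrict (Icc 0 T))) : MemLp f 2 (weightedMeasure T ω) :=
  hf.of_measure_le_smul ENNReal.ofReal_ne_top (weightedMeasure_le T ω)

section MatrixOps

variable {κ ι : Type*} [Fintype κ] [Fintype ι] [DecidableEq κ]

/-- `A x` for a matrix `A` and a vector `x` in Euclidean space. -/
abbrev mulVecE (A : Matrix ι κ ℝ) (x : EuclideanSpace ℝ κ) : EuclideanSpace ℝ ι :=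
  Matrix.toEuclideanLin A x

/-- The multiplication operator `x ↦ (t ↦ A (x t))` from `L²_ω([0,T], ℝ^κ)` to
`L²_ω([0,T], ℝ^ι)`. -/
def mulOp (T ω : ℝ) (A : Matrix ι κ ℝ) : WeightedL2 T ω κ →L[ℝ] WeightedL2 T ω ι :=
  (LinearMap.toContinuousLinearMap (Matrix.toEuclideanLin A)).compLpL 2 (weightedMeasure T ω)

open scoped MatrixOrder in
/-- The positive semidefinite square root `A^{1/2}` of a positive semidefinite matrix `A`. -/
def psdSqrt (A : Matrix κ κ ℝ) : Matrix κ κ ℝ := CFC.sqrt A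

end MatrixOps

/-! ### Coupled port-Hamiltonian systems -/

/-- The index set of the state space `ℝ^n`, `n = n₁ + ⋯ + n_s`, split into `s` blocks. -/
abbrev StateIdx {s : ℕ} (n : Fin s → ℕ) := (i : Fin s) × Fin (n i)

/-- The blocks of the matrices of a system
`d/dt E x = (J - R) Q x + B u` composed of `s` subsystems. -/
structure CoupledSystem {s : ℕ} (n : Fin s → ℕ) (m : ℕ) where
  /-- The diagonal blocks `E_i`. -/
  Eb : ∀ i, Matrix (Fin (n i)) (Fin (n i)) ℝ
  /-- The diagonal blocks `R_i`. -/
  Rb : ∀ i, Matrix (Fin (n i)) (Fin (n i)) ℝ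
  /-- The diagonal blocks `Q_i`. -/
  Qb : ∀ i, Matrix (Fin (n i)) (Fin (n i)) ℝ
  /-- The diagonal blocks `J_i`. -/
  Jb : ∀ i, Matrix (Fin (n i)) (Fin (n i)) ℝ
  /-- The blocks `J_ij`, `i < j`, above the diagonal. -/
  Jc : ∀ i j, i < j → Matrix (Fin (n i)) (Fin (n j)) ℝ
  /-- The blocks `B_i`. -/
  Bb : ∀ i, Matrix (Fin (n i)) (Fin m) ℝ

namespace CoupledSystem

variable {s : ℕ} {n : Fin s → ℕ} {m : ℕ} (S : CoupledSystem n m)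

/-- `E = diag(E_1, …, E_s)`. -/
def E : Matrix (StateIdx n) (StateIdx n) ℝ := Matrix.blockDiagonal' S.Eb

/-- `R = diag(R_1, …, R_s)`. -/
def R : Matrix (StateIdx n) (StateIdx n) ℝ := Matrix.blockDiagonal' S.Rb

/-- `Q = diag(Q_1, …, Q_s)`. -/
def Q : Matrix (StateIdx n) (StateIdx n) ℝ := Matrix.blockDiagonal' S.Qb

/-- The block diagonal part `J_d = diag(J_1, …, J_s)` of `J`. -/
def Jd : Matrix (StateIdx n) (StateIdx n) ℝ := Matrix.blockDiagonal' S.Jb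

/-- The block off-diagonal part `J_o` of `J`, with blocks `J_ij` for `i < j` and `-J_jiᵀ` for
`j < i`. -/
def Jo : Matrix (StateIdx n) (StateIdx n) ℝ := Matrix.of fun p q =>
  if h : p.1 < q.1 then S.Jc p.1 q.1 h p.2 q.2
  else if h : q.1 < p.1 then - S.Jc q.1 p.1 h q.2 p.2
  else 0

/-- `J = J_d + J_o`. -/
def J : Matrix (StateIdx n) (StateIdx n) ℝ := S.Jd + S.Jo

/-- `B = [B_1; …; B_s]`. -/
def B : Matrix (StateIdx n) (Fin m) ℝ := Matrix.of fun p k => S.Bb p.1 p.2 k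

/-- The consistency condition on the input `u` and the initial value `x₀`: for matrices `Z`, `Z₁`
with full column rank, `im Z = ker E` and `im Z₁ = ker RQZ ∩ ker ZᵀQᵀJQZ`, one has
`Z₁ᵀZᵀQᵀBu ∈ H¹` and `Z₁ᵀZᵀQᵀ(JQx₀ + Bu(0)) = 0`, where `Z₁ᵀZᵀQᵀBu(0)` is the value at `0` of the
`H¹`-function. (The condition does not depend on the choice of `Z` and `Z₁`.) -/
def Consistent (T : ℝ) (x₀ : EuclideanSpace ℝ (StateIdx n))
    (u : ℝ → EuclideanSpace ℝ (Fin m)) : Prop :=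
  ∃ (r r₁ : ℕ) (Z : Matrix (StateIdx n) (Fin r) ℝ) (Z₁ : Matrix (Fin r) (Fin r₁) ℝ),
    Z.rank = r ∧ Z₁.rank = r₁ ∧
    LinearMap.range Z.mulVecLin = LinearMap.ker S.E.mulVecLin ∧
    LinearMap.range Z₁.mulVecLin =
      LinearMap.ker (S.R * S.Q * Z).mulVecLin ⊓
        LinearMap.ker (Zᵀ * S.Qᵀ * S.J * S.Q * Z).mulVecLin ∧
    MemH1 T (fun t => mulVecE (Z₁ᵀ * Zᵀ * S.Qᵀ * S.B) (u t)) ∧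
    ∃ a, HasValueAt T (fun t => mulVecE (Z₁ᵀ * Zᵀ * S.Qᵀ * S.B) (u t)) 0 a ∧
      mulVecE (Z₁ᵀ * Zᵀ * S.Qᵀ * S.J * S.Q) x₀ + a = 0

/-- The assumptions on an overall coupled port-Hamiltonian DAE
`d/dt E x = (J - R) Q x + B u` on `[0,T]`, `E x(0) = E x₀`. -/
structure IsCoupledPHDAE (T : ℝ) (x₀ : EuclideanSpace ℝ (StateIdx n))
    (u : Lp (EuclideanSpace ℝ (Fin m)) 2 (volume.restrict (Icc 0 T))) : Prop where
  /-- `R_i = R_iᵀ ≥ 0`. -/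
  R_psd : ∀ i, (S.Rb i).PosSemidef
  /-- `J_iᵀ = -J_i`. -/
  J_skew : ∀ i, (S.Jb i)ᵀ = - S.Jb i
  /-- `E_iᵀ Q_i = Q_iᵀ E_i ≥ 0`. -/
  EQ_symm : ∀ i, (S.Eb i)ᵀ * S.Qb i = (S.Qb i)ᵀ * S.Eb i
  EQ_psd : ∀ i, ((S.Eb i)ᵀ * S.Qb i).PosSemidef
  /-- `Q_i` is invertible. -/
  Q_inv : ∀ i, IsUnit (S.Qb i)
  /-- `rk [E R J] = n`. -/
  rank_eq : (Matrix.fromCols S.E (Matrix.fromCols S.R S.J)).rank = Fintype.card (StateIdx n)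
  T_pos : 0 < T
  consistent : S.Consistent T x₀ u

variable (T ω μ α : ℝ) (x₀ : EuclideanSpace ℝ (StateIdx n))
  (u : Lp (EuclideanSpace ℝ (Fin m)) 2 (volume.restrict (Icc 0 T)))

/-- `D(M) = {x ∈ L²_ω | E x ∈ H¹, E x(0) = E x₀}`. -/
def domM : Set (WeightedL2 T ω (StateIdx n)) :=
  {x | MemH1 T (fun t => mulVecE S.E (x t)) ∧
    HasValueAt T (fun t => mulVecE S.E (x t)) 0 (mulVecE S.E x₀)}

/-- The affine operator `M : D(M) ⊂ L²_ω → L²_ω`,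
`M x = d/dt (E x) - (J_d - α R + μ E Q⁻¹) Q x - B u`. -/
def M : WeightedL2 T ω (StateIdx n) →. WeightedL2 T ω (StateIdx n) := fun x =>
  ⟨x ∈ S.domM T ω x₀, fun hx =>
    (memLp_weighted ω hx.1.hasWeakDeriv.memLp_deriv).toLp hx.1.weakDeriv
      - mulOp T ω ((S.Jd - α • S.R + μ • (S.E * S.Q⁻¹)) * S.Q) x
      - mulOp T ω S.B ((memLp_weighted ω (Lp.memLp u)).toLp u)⟩

/-- The operator `M Q⁻¹`, with domain `Q D(M) = {v | Q⁻¹ v ∈ D(M)}`. -/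
def MQinv : WeightedL2 T ω (StateIdx n) →. WeightedL2 T ω (StateIdx n) := fun v =>
  S.M T ω μ α x₀ u (mulOp T ω S.Q⁻¹ v)

end CoupledSystem

end PHDAE

end

/-! Put `P = E Q⁻¹` and `N = J_d - α R + μ P`, so that `M Q⁻¹ v = (P v)' - N v - B u`. Since `EᵀQ`
is symmetric and positive semidefinite, so is `P`.

Energy identity (`inner_MQinv_sub`): for `d = v - w` the input and the initial value cancel, so `P
d` is in `H¹` and vanishes at `0`. With `S = P^{1/2}`, the function `z = S d` has a representative
that is a primitive, and `(P d)' = S z'`. Hence `⟪(P d)', d⟫ = ⟪z', z⟫`, which is half the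
derivative of `‖z‖²`. Integration by parts against `e^{-2tω}` gives the boundary term at `T` and `ω
‖z‖²`. In `-⟪N d, d⟫` the skew part drops out, leaving `α ‖R^{1/2} d‖² - μ ‖z‖²`.

Surjectivity (`exists_add_smul_MQinv_eq`): `v + λ M Q⁻¹ v = y` is the DAE `(P v)' + K v = f` with `K
= λ⁻¹ - N`. On `ker P` one has `⟪x, K x⟫ = λ⁻¹ ‖x‖² + α ‖R^{1/2} x‖²`, so the DAE has index at most
one. The component of the equation in `ker P` is an algebraic constraint that recovers `v` from `P
v`, and `P v` solves a linear ODE (`exists_solution_dae`).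

Maximality follows from monotonicity and surjectivity of `I + M Q⁻¹`, the easy half of Minty's
theorem. Since `H¹` is defined by test functions, `exists_ae_eq_primitive` and
`hasWeakDeriv_primitive` first identify its elements with primitives of `L²` functions. -/

namespace PHDAE

/-! ### Primitives of integrable functions -/

section Primitive

/-- Integration by parts for two primitives and a continuously differentiable weight. -/
theorem integral_deriv_weight_mul_primitive_mul_primitive {T : ℝ} {ρ f g : ℝ → ℝ} (a b : ℝ)
    (hρ : ContDiff ℝ 1 ρ) (hf : IntervalIntegrable f volume 0 T)
    (hg : IntervalIntegrable g volume 0 T) :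
    ∫ t in (0 : ℝ)..T, (deriv ρ t * ((a + ∫ s in (0 : ℝ)..t, f s) * (b + ∫ s in (0 : ℝ)..t, g s))
        + ρ t * (f t * (b + ∫ s in (0 : ℝ)..t, g s) + (a + ∫ s in (0 : ℝ)..t, f s) * g t))
      = ρ T * ((a + ∫ s in (0 : ℝ)..T, f s) * (b + ∫ s in (0 : ℝ)..T, g s)) - ρ 0 * (a * b) := by
  have hac : ∀ {k : ℝ → ℝ} (c : ℝ), IntervalIntegrable k volume 0 T →
      AbsolutelyContinuousOnInterval (fun t => c + ∫ s in (0 : ℝ)..t, k s) 0 T := by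
    intro k c hk
    exact (contDiff_const (n := 1)).contDiffOn.absolutelyContinuousOnInterval.add
      (hk.absolutelyContinuousOnInterval_intervalIntegral left_mem_uIcc)
  -- The weight and both primitives are absolutely continuous, hence so is their product. The
  -- fundamental theorem applies with the derivative computed almost everywhere.
  have hF := ((hρ.contDiffOn (s := uIcc 0 T)).absolutelyContinuousOnInterval).fun_mul
    ((hac a hf).fun_mul (hac b hg))
  have key := hF.integral_deriv_eq_sub
  simp only [intervalIntegral.integral_same, add_zero] at key
  rw [← key]
  refine intervalIntegral.integral_congr_ae ?_
  filter_upwards [hf.ae_hasDerivAt_integral, hg.ae_hasDerivAt_integral] with t h1 h2 ht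
  have ht' := uIoc_subset_uIcc ht
  have d1 := (h1 ht' 0 left_mem_uIcc).const_add a
  have d2 := (h2 ht' 0 left_mem_uIcc).const_add b
  have d3 := ((hρ.differentiable one_ne_zero) t).hasDerivAt.mul (d1.mul d2)
  exact d3.deriv.symm

variable {F : Type*} [NormedAddCommGroup F]

theorem MemLp.intervalIntegrable_of_restrict_Icc {T : ℝ} (hT : 0 ≤ T) {g : ℝ → F}
    (hg : MemLp g 2 (volume.restrict (Icc 0 T))) : IntervalIntegrable g volume 0 T := by
  rw [intervalIntegrable_iff_integrableOn_Icc_of_le hT]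
  exact hg.integrable (by norm_num)

theorem memLp_of_continuousOn_Icc {T : ℝ} {z : ℝ → F} (hz : ContinuousOn z (Icc 0 T)) :
    MemLp z 2 (volume.restrict (Icc 0 T)) := by
  obtain ⟨C, hC⟩ := isCompact_Icc.exists_bound_of_continuousOn hz
  refine MemLp.of_bound (hz.aestronglyMeasurable measurableSet_Icc) C ?_
  exact (ae_restrict_iff' measurableSet_Icc).mpr (Filter.Eventually.of_forall hC)

variable [InnerProductSpace ℝ F]

theorem continuousOn_primitive_Icc {T : ℝ} (hT : 0 ≤ T) {g : ℝ → F}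
    (hg : IntervalIntegrable g volume 0 T) (c : F) :
    ContinuousOn (fun t => c + ∫ s in (0 : ℝ)..t, g s) (Icc 0 T) := by
  have := intervalIntegral.continuousOn_primitive_interval' hg left_mem_uIcc
  rw [uIcc_of_le hT] at this
  exact continuousOn_const.add this

variable [FiniteDimensional ℝ F]

theorem inner_primitive {T : ℝ} {g : ℝ → F} (hg : IntervalIntegrable g volume 0 T) (c a : F)
    {t : ℝ} (ht : t ∈ Icc 0 T) :
    inner ℝ c (a + ∫ s in (0 : ℝ)..t, g s) = inner ℝ c a + ∫ s in (0 : ℝ)..t, inner ℝ c (g s) := by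
  have hs : IntervalIntegrable g volume 0 t := hg.mono_set (by
    rw [uIcc_of_le ht.1, uIcc_of_le (ht.1.trans ht.2)]; exact Icc_subset_Icc_right ht.2)
  rw [inner_add_right]
  congr 1
  exact ((innerSL ℝ c).intervalIntegral_comp_comm hs).symm

/-- The weighted energy identity for a primitive vanishing at `0`. -/
theorem integral_exp_inner_primitive {T : ℝ} (hT : 0 ≤ T) (ω : ℝ) {g z : ℝ → F}
    (hg : IntervalIntegrable g volume 0 T)
    (hz : ∀ t ∈ Icc 0 T, z t = ∫ s in (0 : ℝ)..t, g s) :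
    ∫ t in (0 : ℝ)..T, Real.exp (-2 * t * ω) * inner ℝ (g t) (z t)
      = 1 / 2 * Real.exp (-2 * T * ω) * ‖z T‖ ^ 2
        + ω * ∫ t in (0 : ℝ)..T, Real.exp (-2 * t * ω) * ‖z t‖ ^ 2 := by
  -- Integration by parts is available for scalar functions, so the identity is proved for each
  -- coordinate and summed.
  let b := stdOrthonormalBasis ℝ F
  have hzc : ContinuousOn z (Icc 0 T) := by
    refine (continuousOn_primitive_Icc hT hg 0).congr fun t ht => ?_
    simp [hz t ht]
  have hexp : ContDiff ℝ 1 fun t : ℝ => Real.exp (-2 * t * ω) := by fun_prop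
  have hder : ∀ t : ℝ, deriv (fun t : ℝ => Real.exp (-2 * t * ω)) t
      = -2 * ω * Real.exp (-2 * t * ω) := by
    intro t
    have h : HasDerivAt (fun t : ℝ => -2 * t * ω) (-2 * ω) t := by
      simpa using ((hasDerivAt_id t).const_mul (-2)).mul_const ω
    rw [h.exp.deriv]; ring
  have hgi : ∀ i, IntervalIntegrable (fun t => inner ℝ (b i) (g t)) volume 0 T := fun i => by
    rw [intervalIntegrable_iff] at hg ⊢
    exact hg.const_inner _
  have hzi : ∀ i, ContinuousOn (fun t => inner ℝ (b i) (z t)) (uIcc 0 T) := fun i => by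
    rw [uIcc_of_le hT]; exact continuousOn_const.inner hzc
  have hpi : ∀ i, IntervalIntegrable
      (fun t => Real.exp (-2 * t * ω) * (inner ℝ (b i) (g t) * inner ℝ (b i) (z t))) volume 0 T :=
    fun i => ((hgi i).mul_continuousOn (hzi i)).continuousOn_mul hexp.continuous.continuousOn
  have hqi : ∀ i, IntervalIntegrable
      (fun t => Real.exp (-2 * t * ω) * (inner ℝ (b i) (z t) * inner ℝ (b i) (z t))) volume 0 T :=
    fun i => (hexp.continuous.continuousOn.mul ((hzi i).mul (hzi i))).intervalIntegrable
  have key : ∀ i, ∫ t in (0 : ℝ)..T,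
      Real.exp (-2 * t * ω) * (inner ℝ (b i) (g t) * inner ℝ (b i) (z t))
      = 1 / 2 * Real.exp (-2 * T * ω) * (inner ℝ (b i) (z T) * inner ℝ (b i) (z T))
        + ω * ∫ t in (0 : ℝ)..T,
          Real.exp (-2 * t * ω) * (inner ℝ (b i) (z t) * inner ℝ (b i) (z t)) := by
    intro i
    have hval : ∀ t ∈ Icc 0 T, 0 + ∫ s in (0 : ℝ)..t, inner ℝ (b i) (g s) = inner ℝ (b i) (z t) := by
      intro t ht
      have := inner_primitive hg (b i) 0 ht
      rw [hz t ht]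
      simpa using this.symm
    have h0 := integral_deriv_weight_mul_primitive_mul_primitive 0 0 hexp (hgi i) (hgi i)
    rw [hval T (right_mem_Icc.mpr hT)] at h0
    -- With equal factors the product rule gives the same term twice, and the weight contributes
    -- `-2ω` times itself. Halving produces the constants `1/2` and `ω`.
    have h1 : ∫ t in (0 : ℝ)..T,
        (2 * (Real.exp (-2 * t * ω) * (inner ℝ (b i) (g t) * inner ℝ (b i) (z t)))
        - 2 * ω * (Real.exp (-2 * t * ω) * (inner ℝ (b i) (z t) * inner ℝ (b i) (z t))))
        = Real.exp (-2 * T * ω) * (inner ℝ (b i) (z T) * inner ℝ (b i) (z T)) := by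
      simp only [mul_zero, sub_zero] at h0
      rw [← h0]
      refine intervalIntegral.integral_congr fun t ht => ?_
      rw [uIcc_of_le hT] at ht
      simp only [hval t ht, hder]
      ring
    rw [intervalIntegral.integral_sub ((hpi i).const_mul 2) ((hqi i).const_mul (2 * ω)),
      intervalIntegral.integral_const_mul, intervalIntegral.integral_const_mul] at h1
    linarith
  have hin : ∀ x y : F, inner ℝ x y = ∑ i, inner ℝ (b i) x * inner ℝ (b i) y := by
    intro x y
    rw [← b.sum_inner_mul_inner x y]
    simp only [real_inner_comm]
  have hn : ∀ x : F, ‖x‖ ^ 2 = ∑ i, inner ℝ (b i) x * inner ℝ (b i) x := fun x => by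
    rw [← real_inner_self_eq_norm_sq, hin]
  simp only [hn, hin (g _) (z _), Finset.mul_sum]
  rw [intervalIntegral.integral_finsetSum fun i _ => hpi i,
    intervalIntegral.integral_finsetSum fun i _ => hqi i, Finset.sum_congr rfl fun i _ => key i,
    Finset.sum_add_distrib, Finset.mul_sum]

end Primitive

/-! ### Weak derivatives and primitives -/

section Weak

variable {F : Type*} [NormedAddCommGroup F]

/-- Makes point values well defined; for `T = 0` the interval is a null set and this would fail. -/
theorem IsContRep.eqOn {T : ℝ} (hT : 0 < T) {f z w : ℝ → F} (hz : IsContRep T f z)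
    (hw : IsContRep T f w) : EqOn z w (Icc 0 T) :=
  Measure.eqOn_Icc_of_ae_eq volume hT.ne (hz.2.trans hw.2.symm) hz.1 hw.1

variable [InnerProductSpace ℝ F]

theorem HasWeakDeriv.congr_ae {T : ℝ} {f f' g g' : ℝ → F} (h : HasWeakDeriv T f g)
    (hf : f =ᵐ[volume.restrict (Icc 0 T)] f') (hg : g =ᵐ[volume.restrict (Icc 0 T)] g') :
    HasWeakDeriv T f' g' where
  memLp := h.memLp.ae_eq hf
  memLp_deriv := h.memLp_deriv.ae_eq hg
  integral_eq φ hφ hc hs := by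
    have e1 : ∫ t in Icc 0 T, deriv φ t • f' t = ∫ t in Icc 0 T, deriv φ t • f t :=
      integral_congr_ae (hf.mono fun t ht => by simp only [ht])
    have e2 : ∫ t in Icc 0 T, φ t • g' t = ∫ t in Icc 0 T, φ t • g t :=
      integral_congr_ae (hg.mono fun t ht => by simp only [ht])
    rw [e1, e2, h.integral_eq φ hφ hc hs]

theorem integrableOn_smul_of_memLp {T : ℝ} {φ : ℝ → ℝ} (hφ : Continuous φ) {k : ℝ → F}
    (hk : MemLp k 2 (volume.restrict (Icc 0 T))) :
    IntegrableOn (fun t => φ t • k t) (Icc 0 T) := by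
  have : IntegrableOn k (Icc 0 T) := hk.integrable (by norm_num)
  exact this.continuousOn_smul hφ.continuousOn isCompact_Icc

theorem continuous_deriv_of_contDiff_top {φ : ℝ → ℝ} (hφ : ContDiff ℝ (⊤ : ℕ∞) φ) :
    Continuous (deriv φ) :=
  hφ.continuous_deriv (by exact_mod_cast le_top)

theorem HasWeakDeriv.sub {T : ℝ} {f f' g g' : ℝ → F} (h : HasWeakDeriv T f g)
    (h' : HasWeakDeriv T f' g') : HasWeakDeriv T (fun t => f t - f' t) (fun t => g t - g' t) where
  memLp := h.memLp.sub h'.memLp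
  memLp_deriv := h.memLp_deriv.sub h'.memLp_deriv
  integral_eq φ hφ hc hs := by
    have hd := continuous_deriv_of_contDiff_top hφ
    simp only [smul_sub]
    rw [integral_sub (integrableOn_smul_of_memLp hd h.memLp)
        (integrableOn_smul_of_memLp hd h'.memLp),
      integral_sub (integrableOn_smul_of_memLp hφ.continuous h.memLp_deriv)
        (integrableOn_smul_of_memLp hφ.continuous h'.memLp_deriv),
      h.integral_eq φ hφ hc hs, h'.integral_eq φ hφ hc hs]
    abel

variable [FiniteDimensional ℝ F]

theorem HasWeakDeriv.clm_comp {T : ℝ} {f g : ℝ → F} (h : HasWeakDeriv T f g) (L : F →L[ℝ] F) :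
    HasWeakDeriv T (fun t => L (f t)) (fun t => L (g t)) where
  memLp := L.comp_memLp' h.memLp
  memLp_deriv := L.comp_memLp' h.memLp_deriv
  integral_eq φ hφ hc hs := by
    have hd := continuous_deriv_of_contDiff_top hφ
    simp only [← L.map_smul]
    rw [L.integral_comp_comm (integrableOn_smul_of_memLp hd h.memLp),
      L.integral_comp_comm (integrableOn_smul_of_memLp hφ.continuous h.memLp_deriv),
      h.integral_eq φ hφ hc hs, map_neg]

/-- A primitive of a square integrable function belongs to `H¹`. -/
theorem hasWeakDeriv_primitive {T : ℝ} (hT : 0 ≤ T) {g : ℝ → F}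
    (hg : MemLp g 2 (volume.restrict (Icc 0 T))) (c : F) :
    HasWeakDeriv T (fun t => c + ∫ s in (0 : ℝ)..t, g s) g where
  memLp := memLp_of_continuousOn_Icc
    (continuousOn_primitive_Icc hT (MemLp.intervalIntegrable_of_restrict_Icc hT hg) c)
  memLp_deriv := hg
  integral_eq φ hφ hc hs := by
    have hgi := MemLp.intervalIntegrable_of_restrict_Icc hT hg
    have hcont := continuousOn_primitive_Icc hT hgi c
    have hd := continuous_deriv_of_contDiff_top hφ
    have hφ0 : φ 0 = 0 := image_eq_zero_of_notMem_tsupport fun h => (hs h).1.false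
    have hφT : φ T = 0 := image_eq_zero_of_notMem_tsupport fun h => (hs h).2.false
    refine ext_inner_left ℝ fun e => ?_
    have i1 := integrableOn_smul_of_memLp hd (memLp_of_continuousOn_Icc hcont)
    have i2 := integrableOn_smul_of_memLp hφ.continuous hg
    rw [← integral_inner i1, inner_neg_right, ← integral_inner i2]
    have hge : IntervalIntegrable (fun t => inner ℝ e (g t)) volume 0 T := by
      rw [intervalIntegrable_iff] at hgi ⊢
      exact hgi.const_inner _
    -- The weight is the test function and the second factor is the constant `1 = 1 + ∫ 0`. The
    -- boundary terms vanish because `φ 0 = φ T = 0`.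
    have h0 := integral_deriv_weight_mul_primitive_mul_primitive (inner ℝ e c) 1
      (hφ.of_le (by exact_mod_cast le_top)) hge
      (intervalIntegrable_const (c := (0 : ℝ)))
    rw [hφ0, hφT] at h0
    simp only [intervalIntegral.integral_zero, add_zero, mul_one, mul_zero, zero_mul, sub_zero]
      at h0
    rw [intervalIntegral.integral_of_le hT, ← integral_Icc_eq_integral_Ioc] at h0
    rw [eq_neg_iff_add_eq_zero, ← integral_add (i1.const_inner e) (i2.const_inner e)]
    refine Eq.trans ?_ h0
    refine setIntegral_congr_fun measurableSet_Icc fun t ht => ?_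
    simp only [inner_smul_right, inner_primitive hgi e c ht]

/-- A function on `(0,T)` that annihilates all derivatives of test functions is constant. -/
theorem exists_ae_eq_const_of_integral_deriv_smul_eq_zero {T : ℝ} (hT : 0 < T) {h : ℝ → F}
    (hh : MemLp h 2 (volume.restrict (Icc 0 T)))
    (h0 : ∀ φ : ℝ → ℝ, ContDiff ℝ (⊤ : ℕ∞) φ → HasCompactSupport φ → tsupport φ ⊆ Ioo 0 T →
      ∫ t in Icc 0 T, deriv φ t • h t = 0) :
    ∃ c : F, h =ᵐ[volume.restrict (Icc 0 T)] fun _ => c := by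
  -- A bump `χ` with nonzero integral `m` corrects any test function to mean zero. The constant
  -- sought must be the `χ`-weighted mean of `h`.
  obtain ⟨χ, hχs, hχc, hχ, hχ1, hχ2⟩ := exists_contDiff_tsupport_subset (n := (⊤ : ℕ∞))
    (isOpen_Ioo.mem_nhds (show T / 2 ∈ Ioo 0 T from ⟨by linarith, by linarith⟩))
  have hχint : 0 < ∫ t in (0 : ℝ)..T, χ t := by
    refine intervalIntegral.integral_pos hT hχ.continuous.continuousOn (fun x _ => ?_)
      ⟨T / 2, ⟨by linarith, by linarith⟩, by rw [hχ2]; norm_num⟩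
    exact (hχ1 (mem_range_self x)).1
  set m : ℝ := ∫ t in (0 : ℝ)..T, χ t with hm
  refine ⟨m⁻¹ • ∫ t in Icc 0 T, χ t • h t, ?_⟩
  set c : F := m⁻¹ • ∫ t in Icc 0 T, χ t • h t with hc
  have hconst : MemLp (fun _ : ℝ => c) 2 (volume.restrict (Icc 0 T)) := memLp_const c
  have hhc := hh.sub hconst
  have key : ∀ᵐ t, t ∈ Ioo 0 T → (h - (fun _ => c : ℝ → F)) t = 0 := by
    refine isOpen_Ioo.ae_eq_zero_of_integral_contDiff_smul_eq_zero ?_ ?_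
    · have : IntegrableOn (h - (fun _ => c : ℝ → F)) (Icc 0 T) := hhc.integrable (by norm_num)
      exact (this.mono_set Ioo_subset_Icc_self).locallyIntegrableOn
    intro φ hφ hφc hφs
    -- This `k` makes `φ - k χ` have integral zero, so its primitive `Ψ` is again a test function,
    -- to which `h0` applies.
    set k : ℝ := m⁻¹ * ∫ t in (0 : ℝ)..T, φ t with hk
    let ψ : ℝ → ℝ := fun t => φ t - k * χ t
    have hψ : ContDiff ℝ (⊤ : ℕ∞) ψ := hφ.sub (contDiff_const.mul hχ)
    let Ψ : ℝ → ℝ := fun t => ∫ s in (0 : ℝ)..t, ψ s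
    have hΨd : ∀ t, HasDerivAt Ψ (ψ t) t := fun t =>
      intervalIntegral.integral_hasDerivAt_right (hψ.continuous.intervalIntegrable _ _)
        (hψ.continuous.stronglyMeasurableAtFilter _ _) hψ.continuous.continuousAt
    have hderiv : deriv Ψ = ψ := funext fun t => (hΨd t).deriv
    have hΨ : ContDiff ℝ (⊤ : ℕ∞) Ψ := by
      rw [contDiff_infty_iff_deriv, hderiv]
      exact ⟨fun t => (hΨd t).differentiableAt, hψ⟩
    have hψT : ∫ s in (0 : ℝ)..T, ψ s = 0 := by
      rw [intervalIntegral.integral_sub (hφ.continuous.intervalIntegrable _ _)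
        ((hχ.continuous.intervalIntegrable _ _).const_mul k), intervalIntegral.integral_const_mul,
        ← hm, hk]
      field_simp
      ring
    have hKc : IsCompact (tsupport φ ∪ tsupport χ) := hφc.isCompact.union hχc.isCompact
    have hKn : (tsupport φ ∪ tsupport χ).Nonempty :=
      ⟨T / 2, Or.inr (subset_tsupport _ (by simp [hχ2]))⟩
    obtain ⟨a, haK, ha⟩ := hKc.exists_isLeast hKn
    obtain ⟨b, hbK, hb⟩ := hKc.exists_isGreatest hKn
    have hK : tsupport φ ∪ tsupport χ ⊆ Ioo 0 T := union_subset hφs hχs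
    have hψ0 : ∀ t, t ∉ tsupport φ ∪ tsupport χ → ψ t = 0 := by
      intro t ht
      simp only [mem_union, not_or] at ht
      simp [ψ, image_eq_zero_of_notMem_tsupport ht.1, image_eq_zero_of_notMem_tsupport ht.2]
    have hsupp : tsupport Ψ ⊆ Icc a b := by
      refine closure_minimal (fun t ht => ?_) isClosed_Icc
      by_contra hab
      refine ht ?_
      rw [mem_Icc, not_and_or, not_le, not_le] at hab
      rcases hab with hta | htb
      · have : ∫ s in (0 : ℝ)..t, ψ s = ∫ s in (0 : ℝ)..t, (0 : ℝ) := by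
          refine intervalIntegral.integral_congr fun s hs => hψ0 s fun hsK => ?_
          have h1 : s ≤ max 0 t := hs.2
          have h2 := ha hsK
          exact absurd (h2.trans h1) (not_le.mpr (max_lt (hK haK).1 hta))
        simp only [Ψ, this, intervalIntegral.integral_zero]
      -- To the right of the supports, mean zero is what makes `Ψ` vanish: `Ψ t = -∫ s in t..T, ψ
      -- s`.
      · have : ∫ s in t..T, ψ s = ∫ s in t..T, (0 : ℝ) := by
          refine intervalIntegral.integral_congr fun s hs => hψ0 s fun hsK => ?_
          have h1 : min t T ≤ s := hs.1
          have h2 := hb hsK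
          exact absurd (h1.trans h2) (not_le.mpr (lt_min htb (hK hbK).2))
        have hadd := intervalIntegral.integral_add_adjacent_intervals (a := 0) (b := t) (c := T)
          (hψ.continuous.intervalIntegrable _ _ (μ := volume))
          (hψ.continuous.intervalIntegrable _ _)
        rw [this, hψT, intervalIntegral.integral_zero, add_zero] at hadd
        exact hadd
    have e := h0 Ψ hΨ (isCompact_Icc.of_isClosed_subset (isClosed_tsupport _) hsupp)
      (hsupp.trans fun t ht => ⟨(hK haK).1.trans_le ht.1, ht.2.trans_lt (hK hbK).2⟩)
    rw [hderiv] at e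
    have iφ := integrableOn_smul_of_memLp hφ.continuous hh
    have iχ := integrableOn_smul_of_memLp hχ.continuous hh
    have iχk : IntegrableOn (fun t => k • χ t • h t) (Icc 0 T) := iχ.smul k
    have e1 : ∫ t in Icc 0 T, φ t • h t = k • ∫ t in Icc 0 T, χ t • h t := by
      rw [← integral_smul, ← sub_eq_zero, ← integral_sub iφ iχk, ← e]
      refine integral_congr_ae (Filter.Eventually.of_forall fun t => ?_)
      simp [ψ, sub_smul, mul_smul]
    have e2 : ∫ t in Icc 0 T, φ t • c = k • ∫ t in Icc 0 T, χ t • h t := by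
      rw [integral_smul_const, integral_Icc_eq_integral_Ioc, ← intervalIntegral.integral_of_le hT.le,
        hc, smul_smul, hk, mul_comm]
    have e3 : ∫ t in Icc 0 T, φ t • (h - (fun _ => c : ℝ → F)) t = 0 := by
      simp only [Pi.sub_apply, smul_sub]
      rw [integral_sub iφ (integrableOn_smul_of_memLp hφ.continuous hconst), e1, e2, sub_self]
    rw [← e3, eq_comm]
    refine setIntegral_eq_integral_of_forall_compl_eq_zero ?_
    intro t ht
    have : φ t = 0 := image_eq_zero_of_notMem_tsupport
      fun h' => ht (Ioo_subset_Icc_self (hφs h'))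
    simp [this]
  rw [← Measure.restrict_congr_set (Ioo_ae_eq_Icc (a := (0 : ℝ)) (b := T)), Filter.EventuallyEq,
    ae_restrict_iff' measurableSet_Ioo]
  filter_upwards [key] with t ht hm
  exact sub_eq_zero.mp (ht hm)

/-- A function in `H¹` is almost everywhere a primitive of its weak derivative. -/
theorem HasWeakDeriv.exists_ae_eq_primitive {T : ℝ} (hT : 0 < T) {f g : ℝ → F}
    (h : HasWeakDeriv T f g) :
    ∃ c : F, f =ᵐ[volume.restrict (Icc 0 T)] fun t => c + ∫ s in (0 : ℝ)..t, g s := by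
  have h' := h.sub (hasWeakDeriv_primitive hT.le h.memLp_deriv 0)
  obtain ⟨c, hc⟩ := exists_ae_eq_const_of_integral_deriv_smul_eq_zero hT h'.memLp
    fun φ hφ hφc hφs => by rw [h'.integral_eq φ hφ hφc hφs]; simp
  refine ⟨c, hc.mono fun t ht => ?_⟩
  simp only [zero_add] at ht
  rw [← sub_eq_iff_eq_add, ht]

/-- A function in `H¹` with value `a` at `0` is the primitive of its weak derivative starting
from `a`. -/
theorem HasWeakDeriv.ae_eq_primitive_of_hasValueAt {T : ℝ} (hT : 0 < T) {f g : ℝ → F}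
    (h : HasWeakDeriv T f g) {a : F} (ha : HasValueAt T f 0 a) :
    f =ᵐ[volume.restrict (Icc 0 T)] fun t => a + ∫ s in (0 : ℝ)..t, g s := by
  obtain ⟨c, hc⟩ := h.exists_ae_eq_primitive hT
  obtain ⟨z, hz, rfl⟩ := ha
  -- The primitive is a continuous representative, so it equals `z` also at `0`, where its value is
  -- `c`.
  have hcr : IsContRep T f fun t => c + ∫ s in (0 : ℝ)..t, g s :=
    ⟨continuousOn_primitive_Icc hT.le
      (MemLp.intervalIntegrable_of_restrict_Icc hT.le h.memLp_deriv) c, hc.symm⟩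
  have := hz.eqOn hT hcr (left_mem_Icc.mpr hT.le)
  simp only [intervalIntegral.integral_same, add_zero] at this
  rwa [this]

end Weak

/-! ### Linear differential-algebraic equations -/

section DAE

variable {F : Type*} [NormedAddCommGroup F] [InnerProductSpace ℝ F] [FiniteDimensional ℝ F]

/-- The integral equation `w = w₀ + ∫ (C w + g)` has a continuous solution. -/
theorem exists_continuous_eq_primitive_add (C : F →L[ℝ] F) {g : ℝ → F}
    (hg : ∀ a b, IntervalIntegrable g volume a b) (w₀ : F) :
    ∃ w : ℝ → F, Continuous w ∧ ∀ t, w t = w₀ + ∫ s in (0 : ℝ)..t, (C (w s) + g s) := by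
  -- Subtracting the primitive of `g` leaves `z = w - h` with `z' = C (z + h)`. The right side is
  -- continuous, so variation of constants solves it classically although `g` is only integrable.
  let h : ℝ → F := fun t => ∫ s in (0 : ℝ)..t, g s
  have hh : Continuous h := intervalIntegral.continuous_primitive hg 0
  let A : ℝ → F →L[ℝ] F := fun t => NormedSpace.exp (t • C)
  have hA : ∀ t, HasDerivAt A (C * A t) t := fun t => hasDerivAt_exp_smul_const' C t
  have hAc : Continuous A := continuous_iff_continuousAt.mpr fun t => (hA t).continuousAt
  have hAi : ∀ t, A t * A (-t) = 1 := by
    intro t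
    have hc : Commute (t • C) ((-t) • C) := ((Commute.refl C).smul_left t).smul_right (-t)
    let _ : NormedAlgebra ℚ (F →L[ℝ] F) := NormedAlgebra.restrictScalars ℚ ℝ _
    have h1 : NormedSpace.exp (t • C + (-t) • C)
        = NormedSpace.exp (t • C) * NormedSpace.exp ((-t) • C) :=
      NormedSpace.exp_add_of_commute hc
    rw [← add_smul, add_neg_cancel, zero_smul, NormedSpace.exp_zero] at h1
    exact h1.symm
  let k : ℝ → F := fun s => A (-s) (C (h s))
  have hk : Continuous k := (hAc.comp continuous_neg).clm_apply (C.continuous.comp hh)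
  let z : ℝ → F := fun t => A t (w₀ + ∫ s in (0 : ℝ)..t, k s)
  have hz : ∀ t, HasDerivAt z (C (z t + h t)) t := by
    intro t
    have h1 : HasDerivAt (fun t => w₀ + ∫ s in (0 : ℝ)..t, k s) (k t) t :=
      (intervalIntegral.integral_hasDerivAt_right (hk.intervalIntegrable _ _)
        (hk.stronglyMeasurableAtFilter _ _) hk.continuousAt).const_add w₀
    have h2 := (hA t).clm_apply h1
    have h3 : A t (k t) = C (h t) := by
      change (A t * A (-t)) (C (h t)) = _
      rw [hAi]; rfl
    rw [h3] at h2
    rw [map_add]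
    exact h2
  have hzc : Continuous z := continuous_iff_continuousAt.mpr fun t => (hz t).continuousAt
  have hz0 : z 0 = w₀ := by simp [z, A]
  have hCc : Continuous fun t => C (z t + h t) := C.continuous.comp (hzc.add hh)
  refine ⟨fun t => z t + h t, hzc.add hh, fun t => ?_⟩
  rw [intervalIntegral.integral_add (hCc.intervalIntegrable _ _) (hg 0 t),
    intervalIntegral.integral_eq_sub_of_hasDerivAt (fun s _ => hz s) (hCc.intervalIntegrable _ _),
    hz0]
  simp only [h]
  abel

/-- If `P` is symmetric and `K` is nondegenerate on `ker P`, then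
`v ↦ P v + Π K v` is bijective, where `Π` is the orthogonal projection onto `ker P`. -/
theorem exists_inverse_add_starProjection_ker (P K : F →L[ℝ] F) (hP : P.toLinearMap.IsSymmetric)
    (hK : ∀ x, P x = 0 → inner ℝ x (K x) = 0 → x = 0) :
    ∃ G : F →L[ℝ] F, ∀ y, P (G y) + (LinearMap.ker P.toLinearMap).starProjection (K (G y)) = y := by
  let N := LinearMap.ker P.toLinearMap
  let Φ : F →L[ℝ] F := P + N.starProjection ∘L K
  -- The two summands are orthogonal because `P` is symmetric, so both vanish on the kernel. Then `x
  -- ∈ ker P`, and `⟪x, K x⟫ = ⟪x, Π K x⟫ = 0`.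
  have hinj : Function.Injective Φ.toLinearMap := by
    rw [← LinearMap.ker_eq_bot, LinearMap.ker_eq_bot']
    intro x hx
    have hx' : P x + N.starProjection (K x) = 0 := hx
    have h1 : inner ℝ (P x) (N.starProjection (K x)) = 0 := by
      have : P (N.starProjection (K x)) = 0 := N.starProjection_apply_mem (K x)
      rw [show inner ℝ (P x) (N.starProjection (K x)) = inner ℝ x (P (N.starProjection (K x)))
        from hP _ _, this, inner_zero_right]
    have h2 : P x = 0 := by
      rw [← inner_self_eq_zero (𝕜 := ℝ)]
      nth_rewrite 2 [eq_neg_of_add_eq_zero_left hx']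
      rw [inner_neg_right, h1, neg_zero]
    refine hK x h2 ?_
    rw [h2, zero_add] at hx'
    have h3 : N.starProjection x = x := Submodule.starProjection_eq_self_iff.mpr h2
    rw [← h3, Submodule.inner_starProjection_left_eq_right, h3, hx', inner_zero_right]
  let e := LinearEquiv.ofInjectiveEndo Φ.toLinearMap hinj
  refine ⟨e.symm.toLinearMap.toContinuousLinearMap, fun y => ?_⟩
  exact e.apply_symm_apply y

/-- Solvability of the initial value problem `d/dt (P v) + K v = f`, `(P v)(0) = P v₀` for a
symmetric matrix `P` and a matrix `K` that is nondegenerate on `ker P`. -/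
theorem exists_solution_dae {T : ℝ} (hT : 0 ≤ T) (P K : F →L[ℝ] F)
    (hP : P.toLinearMap.IsSymmetric) (hK : ∀ x, P x = 0 → inner ℝ x (K x) = 0 → x = 0)
    {f : ℝ → F} (hf : MemLp f 2 (volume.restrict (Icc 0 T))) (v₀ : F) :
    ∃ v g : ℝ → F, MemLp v 2 (volume.restrict (Icc 0 T)) ∧ HasWeakDeriv T (fun t => P (v t)) g ∧
      HasValueAt T (fun t => P (v t)) 0 (P v₀) ∧
      ∀ᵐ t ∂volume.restrict (Icc 0 T), g t + K (v t) = f t := by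
  obtain ⟨G, hG⟩ := exists_inverse_add_starProjection_ker P K hP hK
  set N := LinearMap.ker P.toLinearMap
  have hPN : ∀ x, N.starProjection (P x) = 0 := by
    intro x
    rw [Submodule.starProjection_apply_eq_zero_iff, Submodule.mem_orthogonal]
    intro y hy
    have hy' : P y = 0 := hy
    rw [← show inner ℝ (P y) x = inner ℝ y (P x) from hP _ _, hy', inner_zero_left]
  let f' : ℝ → F := (Icc 0 T).indicator f
  have hf' : MemLp f' 2 volume := (memLp_indicator_iff_restrict measurableSet_Icc).mpr hf
  have hff' : f' =ᵐ[volume.restrict (Icc 0 T)] f := indicator_ae_eq_restrict measurableSet_Icc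
  -- `C w + D f'` is `f' - K v` with `v = G ((1 - Π) w + Π f')`. Using `(1 - Π) w` in place of `w`
  -- makes the constraint `Π K v = Π f'` hold before it is known that `Π w = 0`.
  let C : F →L[ℝ] F := -(K ∘L G ∘L (ContinuousLinearMap.id ℝ F - N.starProjection))
  let D : F →L[ℝ] F := ContinuousLinearMap.id ℝ F - K ∘L G ∘L N.starProjection
  have hD : MemLp (fun t => D (f' t)) 2 volume := D.comp_memLp' hf'
  have hDi : ∀ a b, IntervalIntegrable (fun t => D (f' t)) volume a b := fun a b =>
    ((hD.locallyIntegrable (by norm_num)).integrableOn_isCompact isCompact_uIcc).intervalIntegrable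
  obtain ⟨w, hwc, hw⟩ := exists_continuous_eq_primitive_add C hDi (P v₀)
  let v : ℝ → F := fun t => G (w t - N.starProjection (w t) + N.starProjection (f' t))
  have hproj : ∀ x, N.starProjection (N.starProjection x) = N.starProjection x := fun x =>
    Submodule.starProjection_eq_self_iff.mpr (N.starProjection_apply_mem x)
  have hv : ∀ t, P (v t) + N.starProjection (K (v t))
      = w t - N.starProjection (w t) + N.starProjection (f' t) := fun t => hG _
  have hKv : ∀ t, N.starProjection (K (v t)) = N.starProjection (f' t) := by
    intro t
    have := congrArg N.starProjection (hv t)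
    simpa only [map_add, map_sub, hPN, hproj, zero_add, sub_self] using this
  have hCD : ∀ t, C (w t) + D (f' t) = f' t - K (v t) := by
    intro t
    simp only [C, D, v, _root_.neg_apply, ContinuousLinearMap.comp_apply,
      _root_.sub_apply, ContinuousLinearMap.id_apply, map_add, map_sub]
    abel
  -- Neither the initial value `P v₀` nor the right-hand side `f' - K v` has a component in `ker P`,
  -- so `w` never acquires one.
  have hwN : ∀ t, N.starProjection (w t) = 0 := by
    intro t
    have hi : IntervalIntegrable (fun s => C (w s) + D (f' s)) volume 0 t :=
      ((C.continuous.comp hwc).intervalIntegrable _ _).add (hDi 0 t)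
    rw [hw t, map_add, hPN, zero_add, ← N.starProjection.intervalIntegral_comp_comm hi]
    simp only [hCD, map_sub, hKv, sub_self, intervalIntegral.integral_zero]
  have hPv : ∀ t, P (v t) = w t := by
    intro t
    have := hv t
    rw [hKv, hwN, sub_zero] at this
    exact add_right_cancel this
  have hwL : MemLp w 2 (volume.restrict (Icc 0 T)) := memLp_of_continuousOn_Icc hwc.continuousOn
  have hwD := hasWeakDeriv_primitive hT
    ((C.comp_memLp' hwL).add (hD.restrict (Icc 0 T))) (P v₀)
  have hPvw : (fun t => P (v t)) = w := funext hPv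
  refine ⟨v, fun t => C (w t) + D (f' t), ?_, ?_, ?_, ?_⟩
  · exact G.comp_memLp' ((hwL.sub (N.starProjection.comp_memLp' hwL)).add
      (N.starProjection.comp_memLp' (hf'.restrict (Icc 0 T))))
  · rw [hPvw]
    refine hwD.congr_ae (Filter.Eventually.of_forall fun t => (hw t).symm) ?_
    exact Filter.Eventually.of_forall fun t => rfl
  · rw [hPvw]
    exact ⟨w, ⟨hwc.continuousOn, Filter.EventuallyEq.rfl⟩, by rw [hw 0]; simp⟩
  · filter_upwards [hff'] with t ht
    rw [hCD, ht]
    abel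

end DAE

/-! ### Maximal monotonicity -/

section Monotone

variable {X : Type*} [NormedAddCommGroup X] [InnerProductSpace ℝ X]

/-- A monotone operator `A` for which `I + A` is surjective is maximally monotone. -/
theorem isMaximallyMonotone_of_surjective {A : X →. X} (hA : IsMonotoneSet A.graph)
    (hs : ∀ y, ∃ x, ∃ hx : (A x).Dom, x + (A x).get hx = y) : IsMaximallyMonotone A := by
  refine ⟨hA, fun Y hY hAY => hAY.2 fun p hp => ?_⟩
  -- Minty's argument: with `x + A x = p.1 + p.2`, monotonicity against `p` reads `0 ≤ -‖p.1 - x‖²`.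
  obtain ⟨x, hx, hxy⟩ := hs (p.1 + p.2)
  have hmem : ((x, (A x).get hx) : X × X) ∈ A.graph := Part.get_mem hx
  have h := hY p hp _ (hAY.1 hmem)
  have e : p.2 - (A x).get hx = -(p.1 - x) := by
    rw [neg_sub, sub_eq_sub_iff_add_eq_add, add_comm p.2, ← hxy]
  rw [e, inner_neg_right, neg_nonneg] at h
  have h1 : p.1 = x := sub_eq_zero.mp
    (inner_self_eq_zero (𝕜 := ℝ).mp (le_antisymm h real_inner_self_nonneg))
  have h2 : p.2 = (A x).get hx := by
    rw [h1] at hxy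
    exact (add_left_cancel hxy).symm
  have h3 : p = (x, (A x).get hx) := Prod.ext h1 h2
  rw [h3]
  exact hmem

end Monotone

/-! ### The energy identity -/

section Energy

/-- Applied to `P` and `P^{1/2}`, which have the same kernel, this gives `L` with `L P = P^{1/2}`;
regularity of `P d` thus passes to `P^{1/2} d`. -/
theorem exists_comp_eq_of_ker_le {V W : Type*} [AddCommGroup V] [Module ℝ V]
    [AddCommGroup W] [Module ℝ W] (f : V →ₗ[ℝ] V) (g : V →ₗ[ℝ] W)
    (h : LinearMap.ker f ≤ LinearMap.ker g) : ∃ L : V →ₗ[ℝ] W, ∀ x, L (f x) = g x := by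
  obtain ⟨r, hr⟩ := f.rangeRestrict.exists_rightInverse_of_surjective
    (LinearMap.range_eq_top.mpr f.surjective_rangeRestrict)
  obtain ⟨L, hL⟩ := (g ∘ₗ r).exists_extend
  refine ⟨L, fun x => ?_⟩
  have h1 : L (f x) = g (r (f.rangeRestrict x)) := LinearMap.congr_fun hL (f.rangeRestrict x)
  have h2 : f (r (f.rangeRestrict x)) = f x :=
    congrArg Subtype.val (LinearMap.congr_fun hr (f.rangeRestrict x))
  have h3 : r (f.rangeRestrict x) - x ∈ LinearMap.ker g := h (by
    rw [LinearMap.mem_ker, map_sub, h2, sub_self])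
  rw [LinearMap.mem_ker, map_sub, sub_eq_zero] at h3
  rw [h1, h3]

variable {F : Type*} [NormedAddCommGroup F] [InnerProductSpace ℝ F] [FiniteDimensional ℝ F]

/-- If `P = S²` with `S` symmetric and `P d ∈ H¹` vanishes at `0`, then `S d` has a continuous
representative `z`, and `⟪(P d)', d⟫` has the same weighted integral as `⟪z', z⟫`. -/
theorem exists_isContRep_integral_inner_weakDeriv {T : ℝ} (hT : 0 < T) (ω : ℝ) (P S : F →L[ℝ] F)
    (hS : S.toLinearMap.IsSymmetric) (hSP : ∀ x, S (S x) = P x) {d g : ℝ → F}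
    (hd : HasWeakDeriv T (fun t => P (d t)) g) (h0 : HasValueAt T (fun t => P (d t)) 0 0) :
    ∃ z, IsContRep T (fun t => S (d t)) z ∧
      ∫ t in Icc 0 T, Real.exp (-2 * t * ω) * inner ℝ (g t) (d t)
        = 1 / 2 * Real.exp (-2 * T * ω) * ‖z T‖ ^ 2
          + ω * ∫ t in Icc 0 T, Real.exp (-2 * t * ω) * ‖S (d t)‖ ^ 2 := by
  have hker : LinearMap.ker P.toLinearMap ≤ LinearMap.ker S.toLinearMap := by
    intro x hx
    have hx' : P x = 0 := hx
    change S x = 0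
    rw [← inner_self_eq_zero (𝕜 := ℝ), show inner ℝ (S x) (S x) = inner ℝ x (S (S x)) from hS _ _,
      hSP, hx', inner_zero_right]
  obtain ⟨L', hL'⟩ := exists_comp_eq_of_ker_le _ _ hker
  let L : F →L[ℝ] F := L'.toContinuousLinearMap
  have hL : ∀ x, L (P x) = S x := hL'
  have hp := hd.ae_eq_primitive_of_hasValueAt hT h0
  have hgi := MemLp.intervalIntegrable_of_restrict_Icc hT.le hd.memLp_deriv
  -- `S L` is the identity on the range of `P` only. Both sides are weak derivatives of `S L P d = P
  -- d`, so uniqueness gives the claim.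
  have hLg : (fun t => S (L (g t))) =ᵐ[volume.restrict (Icc 0 T)] g := by
    have h1 := (hd.clm_comp L).clm_comp S
    simp only [hL, hSP] at h1
    exact h1.unique hd
  let z : ℝ → F := fun t => L (0 + ∫ s in (0 : ℝ)..t, g s)
  have hz : IsContRep T (fun t => S (d t)) z := by
    refine ⟨L.continuous.comp_continuousOn (continuousOn_primitive_Icc hT.le hgi 0), ?_⟩
    filter_upwards [hp] with t ht
    simp only [z]
    rw [← ht, hL]
  refine ⟨z, hz, ?_⟩
  have hLi : IntervalIntegrable (fun t => L (g t)) volume 0 T :=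
    MemLp.intervalIntegrable_of_restrict_Icc hT.le (L.comp_memLp' hd.memLp_deriv)
  have hzp : ∀ t ∈ Icc 0 T, z t = ∫ s in (0 : ℝ)..t, L (g s) := by
    intro t ht
    have hi : IntervalIntegrable g volume 0 t := hgi.mono_set (by
      rw [uIcc_of_le ht.1, uIcc_of_le hT.le]; exact Icc_subset_Icc_right ht.2)
    simp only [z, zero_add]
    exact (L.intervalIntegral_comp_comm hi).symm
  have key := integral_exp_inner_primitive hT.le ω hLi hzp
  simp only [intervalIntegral.integral_of_le hT.le, ← integral_Icc_eq_integral_Ioc] at key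
  have e1 : ∫ t in Icc 0 T, Real.exp (-2 * t * ω) * inner ℝ (g t) (d t)
      = ∫ t in Icc 0 T, Real.exp (-2 * t * ω) * inner ℝ (L (g t)) (z t) := by
    refine integral_congr_ae ?_
    filter_upwards [hLg, hz.2] with t h1 h2
    rw [h2]
    nth_rewrite 1 [← h1]
    rw [show inner ℝ (S (L (g t))) (d t) = inner ℝ (L (g t)) (S (d t)) from hS _ _]
  have e2 : ∫ t in Icc 0 T, Real.exp (-2 * t * ω) * ‖S (d t)‖ ^ 2
      = ∫ t in Icc 0 T, Real.exp (-2 * t * ω) * ‖z t‖ ^ 2 := by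
    refine integral_congr_ae ?_
    filter_upwards [hz.2] with t h2
    rw [h2]
  rw [e1, e2, key]

end Energy

theorem HasValueAt.congr_ae {F : Type*} [NormedAddCommGroup F] {f f' : ℝ → F}
    {t : ℝ} {a : F} (h : HasValueAt T f t a) (hf : f =ᵐ[volume.restrict (Icc 0 T)] f') :
    HasValueAt T f' t a := by
  obtain ⟨z, hz, rfl⟩ := h
  exact ⟨z, ⟨hz.1, hz.2.trans hf⟩, rfl⟩

/-! ### The weighted space -/

section Weighted

theorem measurable_weight (ω : ℝ) :
    Measurable fun t : ℝ => ENNReal.ofReal (Real.exp (-2 * t * ω)) := by fun_prop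

/-- The density is positive everywhere, so both measures have the same null sets. -/
theorem ae_weightedMeasure_iff {T ω : ℝ} {p : ℝ → Prop} :
    (∀ᵐ t ∂weightedMeasure T ω, p t) ↔ ∀ᵐ t ∂volume.restrict (Icc 0 T), p t := by
  have h1 : weightedMeasure T ω ≪ volume.restrict (Icc 0 T) := withDensity_absolutelyContinuous _ _
  have h2 : volume.restrict (Icc 0 T) ≪ weightedMeasure T ω :=
    withDensity_absolutelyContinuous' (measurable_weight ω).aemeasurable
      (Filter.Eventually.of_forall fun t => by simp [Real.exp_pos])
  exact ⟨fun h => h2.ae_le h, fun h => h1.ae_le h⟩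

/-- The weight is at least `e^{-2|ω||T|}` on `[0,T]`; with `weightedMeasure_le`, the weighted and
unweighted `L²` have the same elements. -/
theorem restrict_le_smul_weightedMeasure (T ω : ℝ) :
    volume.restrict (Icc 0 T) ≤
      ENNReal.ofReal (Real.exp (2 * |ω| * |T|)) • weightedMeasure T ω := by
  have h1 : volume.restrict (Icc 0 T) = (volume.restrict (Icc 0 T)).withDensity 1 :=
    withDensity_one.symm
  rw [weightedMeasure, ← withDensity_smul _ (measurable_weight ω)]
  nth_rewrite 1 [h1]
  refine withDensity_mono ?_
  refine (ae_restrict_iff' measurableSet_Icc).mpr (Filter.Eventually.of_forall fun t ht => ?_)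
  simp only [Pi.one_apply, Pi.smul_apply, smul_eq_mul]
  rw [← ENNReal.ofReal_mul (Real.exp_pos _).le, ← Real.exp_add, ENNReal.one_le_ofReal,
    Real.one_le_exp_iff]
  have h1 : t * ω ≤ |t| * |ω| := by
    rw [← abs_mul]; exact le_abs_self _
  have h2 : |t| ≤ |T| := by
    rw [abs_of_nonneg ht.1]; exact ht.2.trans (le_abs_self T)
  nlinarith [mul_le_mul_of_nonneg_right h2 (abs_nonneg ω)]

theorem memLp_of_weighted {F : Type*} [NormedAddCommGroup F] {T ω : ℝ} {f : ℝ → F}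
    (hf : MemLp f 2 (weightedMeasure T ω)) : MemLp f 2 (volume.restrict (Icc 0 T)) :=
  hf.of_measure_le_smul ENNReal.ofReal_ne_top (restrict_le_smul_weightedMeasure T ω)

theorem integral_weightedMeasure (T ω : ℝ) (f : ℝ → ℝ) :
    ∫ t, f t ∂weightedMeasure T ω = ∫ t in Icc 0 T, Real.exp (-2 * t * ω) * f t := by
  rw [weightedMeasure, integral_withDensity_eq_integral_toReal_smul (measurable_weight ω)
    (Filter.Eventually.of_forall fun t => ENNReal.ofReal_lt_top)]
  simp only [ENNReal.toReal_ofReal (Real.exp_pos _).le, smul_eq_mul]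

variable {κ ι : Type*} [Fintype κ]

theorem inner_weightedL2 {T ω : ℝ} (f g : WeightedL2 T ω κ) :
    inner ℝ f g = ∫ t in Icc 0 T, Real.exp (-2 * t * ω) * inner ℝ (f t) (g t) := by
  rw [L2.inner_def, integral_weightedMeasure]

theorem ext_weightedL2 {T ω : ℝ} {f g : WeightedL2 T ω κ}
    (h : ∀ᵐ t ∂volume.restrict (Icc 0 T), f t = g t) : f = g :=
  Lp.ext (ae_weightedMeasure_iff.mpr h)

theorem coeFn_sub_weightedL2 {T ω : ℝ} (f g : WeightedL2 T ω κ) :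
    ∀ᵐ t ∂volume.restrict (Icc 0 T), (f - g) t = f t - g t :=
  ae_weightedMeasure_iff.mp (Lp.coeFn_sub f g)

variable [DecidableEq κ]

theorem mulVecE_mul (A : Matrix ι κ ℝ) (B : Matrix κ κ ℝ) (x : EuclideanSpace ℝ κ) :
    mulVecE (A * B) x = mulVecE A (mulVecE B x) := by
  simp [mulVecE, Matrix.toLpLin_apply, Matrix.mulVec_mulVec]

theorem coeFn_mulOp [Fintype ι] {T ω : ℝ} (A : Matrix ι κ ℝ) (f : WeightedL2 T ω κ) :
    ∀ᵐ t ∂volume.restrict (Icc 0 T), mulOp T ω A f t = mulVecE A (f t) :=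
  ae_weightedMeasure_iff.mp (ContinuousLinearMap.coeFn_compLpL _ f)

theorem mulOp_mul {T ω : ℝ} (A B : Matrix κ κ ℝ) (f : WeightedL2 T ω κ) :
    mulOp T ω (A * B) f = mulOp T ω A (mulOp T ω B f) := by
  refine ext_weightedL2 ?_
  filter_upwards [coeFn_mulOp (A * B) f, coeFn_mulOp B f, coeFn_mulOp A (mulOp T ω B f)]
    with t h1 h2 h3
  rw [h1, h3, h2, mulVecE_mul]

theorem inner_mulVecE_left (A : Matrix κ κ ℝ) (x y : EuclideanSpace ℝ κ) :
    inner ℝ (mulVecE A x) y = inner ℝ x (mulVecE Aᵀ y) := by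
  rw [← Matrix.conjTranspose_eq_transpose_of_trivial, mulVecE, mulVecE,
    Matrix.toEuclideanLin_conjTranspose_eq_adjoint, LinearMap.adjoint_inner_right]

theorem isSymmetric_mulVecE {A : Matrix κ κ ℝ} (hA : A.PosSemidef) :
    (LinearMap.toContinuousLinearMap (Matrix.toEuclideanLin A)).toLinearMap.IsSymmetric := by
  intro x y
  have h := inner_mulVecE_left A x y
  rwa [← Matrix.conjTranspose_eq_transpose_of_trivial, hA.isHermitian.eq] at h

theorem inner_mulOp_left {T ω : ℝ} (A : Matrix κ κ ℝ) (f g : WeightedL2 T ω κ) :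
    inner ℝ (mulOp T ω A f) g = inner ℝ f (mulOp T ω Aᵀ g) := by
  rw [inner_weightedL2, inner_weightedL2]
  refine integral_congr_ae ?_
  filter_upwards [coeFn_mulOp A f, coeFn_mulOp Aᵀ g] with t h1 h2
  rw [h1, h2, inner_mulVecE_left]

theorem norm_sq_mulOp {T ω : ℝ} (A : Matrix κ κ ℝ) (f : WeightedL2 T ω κ) :
    ‖mulOp T ω A f‖ ^ 2 = ∫ t in Icc 0 T, Real.exp (-2 * t * ω) * ‖mulVecE A (f t)‖ ^ 2 := by
  rw [← real_inner_self_eq_norm_sq, inner_weightedL2]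
  refine integral_congr_ae ?_
  filter_upwards [coeFn_mulOp A f] with t h1
  rw [h1, real_inner_self_eq_norm_sq]

theorem inner_mulVecE_self_of_skew {A : Matrix κ κ ℝ} (hA : Aᵀ = -A) (x : EuclideanSpace ℝ κ) :
    inner ℝ (mulVecE A x) x = 0 := by
  have h := inner_mulVecE_left A x x
  rw [hA, mulVecE, mulVecE, map_neg, LinearMap.neg_apply, inner_neg_right, real_inner_comm] at h
  rw [real_inner_comm, mulVecE]
  linarith

theorem psdSqrt_mul_self {A : Matrix κ κ ℝ} (hA : A.PosSemidef) : psdSqrt A * psdSqrt A = A := by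
  open scoped MatrixOrder in
  exact CFC.sqrt_mul_sqrt_self A hA.nonneg

theorem posSemidef_psdSqrt (A : Matrix κ κ ℝ) : (psdSqrt A).PosSemidef := by
  open scoped MatrixOrder in
  exact (CFC.sqrt_nonneg A).posSemidef

theorem transpose_psdSqrt (A : Matrix κ κ ℝ) : (psdSqrt A)ᵀ = psdSqrt A := by
  rw [← Matrix.conjTranspose_eq_transpose_of_trivial]
  exact (posSemidef_psdSqrt A).isHermitian

theorem inner_mulVecE_self_of_posSemidef {A : Matrix κ κ ℝ} (hA : A.PosSemidef)
    (x : EuclideanSpace ℝ κ) : inner ℝ (mulVecE A x) x = ‖mulVecE (psdSqrt A) x‖ ^ 2 := by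
  nth_rewrite 1 [← psdSqrt_mul_self hA]
  rw [mulVecE_mul, inner_mulVecE_left, transpose_psdSqrt, real_inner_self_eq_norm_sq]

theorem inner_mulOp_self_of_posSemidef {T ω : ℝ} {A : Matrix κ κ ℝ} (hA : A.PosSemidef)
    (f : WeightedL2 T ω κ) : inner ℝ (mulOp T ω A f) f = ‖mulOp T ω (psdSqrt A) f‖ ^ 2 := by
  nth_rewrite 1 [← psdSqrt_mul_self hA]
  rw [mulOp_mul, inner_mulOp_left, transpose_psdSqrt, real_inner_self_eq_norm_sq]

end Weighted

/-! ### Coupled systems -/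

/-- Blockwise square roots assemble to a factorization of the whole matrix as `Cᴴ C`. -/
theorem posSemidef_blockDiagonal' {o : Type*} [Fintype o] [DecidableEq o] {k : o → Type*}
    [∀ i, Fintype (k i)] [∀ i, DecidableEq (k i)] {A : ∀ i, Matrix (k i) (k i) ℝ}
    (hA : ∀ i, (A i).PosSemidef) : (Matrix.blockDiagonal' A).PosSemidef := by
  have h : A = fun i => (psdSqrt (A i))ᴴ * psdSqrt (A i) := funext fun i => by
    rw [(posSemidef_psdSqrt (A i)).isHermitian.eq, psdSqrt_mul_self (hA i)]
  rw [h, Matrix.blockDiagonal'_mul, ← Matrix.blockDiagonal'_conjTranspose]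
  exact Matrix.posSemidef_conjTranspose_mul_self _

namespace CoupledSystem

variable {s : ℕ} {n : Fin s → ℕ} {m : ℕ} {S : CoupledSystem n m} {T : ℝ}
  {x₀ : EuclideanSpace ℝ (StateIdx n)}
  {u : Lp (EuclideanSpace ℝ (Fin m)) 2 (volume.restrict (Icc 0 T))}

theorem IsCoupledPHDAE.isUnit_Q (hS : S.IsCoupledPHDAE T x₀ u) : IsUnit S.Q.det := by
  have h : S.Q * Matrix.blockDiagonal' (fun i => (S.Qb i)⁻¹) = 1 := by
    rw [Q, ← Matrix.blockDiagonal'_mul, ← Matrix.blockDiagonal'_one]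
    congr 1
    funext i
    exact Matrix.mul_nonsing_inv _ ((Matrix.isUnit_iff_isUnit_det _).mp (hS.Q_inv i))
  exact Matrix.isUnit_det_of_right_inverse h

theorem IsCoupledPHDAE.posSemidef_R (hS : S.IsCoupledPHDAE T x₀ u) : S.R.PosSemidef :=
  posSemidef_blockDiagonal' hS.R_psd

theorem IsCoupledPHDAE.transpose_Jd (hS : S.IsCoupledPHDAE T x₀ u) : S.Jdᵀ = -S.Jd := by
  rw [Jd, Matrix.blockDiagonal'_transpose, ← Matrix.blockDiagonal'_neg]
  congr 1
  exact funext hS.J_skew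

/-- Congruence by `Q⁻¹`: because `EᵀQ = QᵀE`, the outer factor cancels in `Q⁻ᵀ (QᵀE) Q⁻¹ = E Q⁻¹`.
-/
theorem IsCoupledPHDAE.posSemidef_E_mul_Q_inv (hS : S.IsCoupledPHDAE T x₀ u) :
    (S.E * S.Q⁻¹).PosSemidef := by
  have h1 : (S.Eᵀ * S.Q).PosSemidef := by
    rw [E, Q, Matrix.blockDiagonal'_transpose, ← Matrix.blockDiagonal'_mul]
    exact posSemidef_blockDiagonal' hS.EQ_psd
  have h2 : S.Eᵀ * S.Q = S.Qᵀ * S.E := by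
    rw [E, Q, Matrix.blockDiagonal'_transpose, Matrix.blockDiagonal'_transpose,
      ← Matrix.blockDiagonal'_mul, ← Matrix.blockDiagonal'_mul]
    congr 1
    exact funext hS.EQ_symm
  have h3 := h1.conjTranspose_mul_mul_same S.Q⁻¹
  rw [h2, Matrix.conjTranspose_eq_transpose_of_trivial, ← Matrix.mul_assoc, ← Matrix.transpose_mul,
    Matrix.mul_nonsing_inv _ hS.isUnit_Q, Matrix.transpose_one, Matrix.one_mul] at h3
  exact h3

theorem IsCoupledPHDAE.mulOp_Q_mul (hS : S.IsCoupledPHDAE T x₀ u) {ω : ℝ}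
    (A : Matrix (StateIdx n) (StateIdx n) ℝ) (v : WeightedL2 T ω (StateIdx n)) :
    mulOp T ω (A * S.Q) (mulOp T ω S.Q⁻¹ v) = mulOp T ω A v := by
  rw [← mulOp_mul, Matrix.mul_assoc, Matrix.mul_nonsing_inv _ hS.isUnit_Q, Matrix.mul_one]

theorem mulVecE_E_mulOp_Q_inv_ae_eq {ω : ℝ} (v : WeightedL2 T ω (StateIdx n)) :
    (fun t => mulVecE S.E (mulOp T ω S.Q⁻¹ v t))
      =ᵐ[volume.restrict (Icc 0 T)] fun t => mulVecE (S.E * S.Q⁻¹) (v t) := by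
  filter_upwards [coeFn_mulOp S.Q⁻¹ v] with t h
  rw [h, mulVecE_mul]

variable (ω μ α : ℝ)

/-- The operator `M Q⁻¹` in terms of the weak derivative of `E Q⁻¹ v`. -/
theorem IsCoupledPHDAE.exists_get_MQinv_eq (hS : S.IsCoupledPHDAE T x₀ u)
    {v : WeightedL2 T ω (StateIdx n)} (hv : (S.MQinv T ω μ α x₀ u v).Dom) :
    ∃ (g : ℝ → EuclideanSpace ℝ (StateIdx n)) (hg : MemLp g 2 (weightedMeasure T ω)),
      HasWeakDeriv T (fun t => mulVecE (S.E * S.Q⁻¹) (v t)) g ∧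
      HasValueAt T (fun t => mulVecE (S.E * S.Q⁻¹) (v t)) 0 (mulVecE S.E x₀) ∧
      (S.MQinv T ω μ α x₀ u v).get hv = hg.toLp g
        - mulOp T ω (S.Jd - α • S.R + μ • (S.E * S.Q⁻¹)) v
        - mulOp T ω S.B ((memLp_weighted ω (Lp.memLp u)).toLp u) := by
  have hv' : mulOp T ω S.Q⁻¹ v ∈ S.domM T ω x₀ := hv
  refine ⟨hv'.1.weakDeriv, memLp_weighted ω hv'.1.hasWeakDeriv.memLp_deriv,
    hv'.1.hasWeakDeriv.congr_ae (mulVecE_E_mulOp_Q_inv_ae_eq v) Filter.EventuallyEq.rfl,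
    hv'.2.congr_ae (mulVecE_E_mulOp_Q_inv_ae_eq v), ?_⟩
  rw [← hS.mulOp_Q_mul (S.Jd - α • S.R + μ • (S.E * S.Q⁻¹)) v]
  rfl

theorem dom_MQinv_of_hasWeakDeriv {v : WeightedL2 T ω (StateIdx n)}
    {g : ℝ → EuclideanSpace ℝ (StateIdx n)}
    (hg : HasWeakDeriv T (fun t => mulVecE (S.E * S.Q⁻¹) (v t)) g)
    (h0 : HasValueAt T (fun t => mulVecE (S.E * S.Q⁻¹) (v t)) 0 (mulVecE S.E x₀)) :
    (S.MQinv T ω μ α x₀ u v).Dom :=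
  ⟨⟨g, hg.congr_ae (mulVecE_E_mulOp_Q_inv_ae_eq v).symm Filter.EventuallyEq.rfl⟩,
    h0.congr_ae (mulVecE_E_mulOp_Q_inv_ae_eq v).symm⟩

/-- The energy identity for differences of elements of the domain of `M Q⁻¹`. -/
theorem IsCoupledPHDAE.inner_MQinv_sub (hS : S.IsCoupledPHDAE T x₀ u)
    {v w : WeightedL2 T ω (StateIdx n)} (hv : (S.MQinv T ω μ α x₀ u v).Dom)
    (hw : (S.MQinv T ω μ α x₀ u w).Dom) :
    ∃ z : ℝ → EuclideanSpace ℝ (StateIdx n),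
      IsContRep T (fun t => mulVecE (psdSqrt (S.E * S.Q⁻¹)) (v t - w t)) z ∧
      inner ℝ ((S.MQinv T ω μ α x₀ u v).get hv - (S.MQinv T ω μ α x₀ u w).get hw) (v - w)
        = 1 / 2 * Real.exp (-2 * T * ω) * ‖z T‖ ^ 2
          + (ω - μ) * ‖mulOp T ω (psdSqrt (S.E * S.Q⁻¹)) (v - w)‖ ^ 2
          + α * ‖mulOp T ω (psdSqrt S.R) (v - w)‖ ^ 2 := by
  obtain ⟨g, hg, hgw, hg0, hgv⟩ := hS.exists_get_MQinv_eq ω μ α hv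
  obtain ⟨k, hk, hkw, hk0, hkv⟩ := hS.exists_get_MQinv_eq ω μ α hw
  have hP := hS.posSemidef_E_mul_Q_inv
  set P := S.E * S.Q⁻¹
  have hd : HasWeakDeriv T (fun t => mulVecE P (v t - w t)) (fun t => g t - k t) := by
    have := hgw.sub hkw
    simpa only [mulVecE, ← map_sub] using this
  have hd0 : HasValueAt T (fun t => mulVecE P (v t - w t)) 0 0 := by
    obtain ⟨z, hz, hz0⟩ := hg0
    obtain ⟨y, hy, hy0⟩ := hk0
    refine ⟨fun t => z t - y t, ⟨hz.1.sub hy.1, ?_⟩, by simp only [hz0, hy0, sub_self]⟩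
    filter_upwards [hz.2, hy.2] with t h1 h2
    rw [h1, h2, mulVecE, ← map_sub]
  obtain ⟨z, hz, hE⟩ := exists_isContRep_integral_inner_weakDeriv hS.T_pos ω
    (LinearMap.toContinuousLinearMap (Matrix.toEuclideanLin P))
    (LinearMap.toContinuousLinearMap (Matrix.toEuclideanLin (psdSqrt P)))
    (isSymmetric_mulVecE (posSemidef_psdSqrt P))
    (fun x => by
      change mulVecE (psdSqrt P) (mulVecE (psdSqrt P) x) = mulVecE P x
      rw [← mulVecE_mul, psdSqrt_mul_self hP]) hd hd0
  refine ⟨z, hz, ?_⟩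
  have hgk : MemLp (fun t => g t - k t) 2 (weightedMeasure T ω) := hg.sub hk
  have e0 : (S.MQinv T ω μ α x₀ u v).get hv - (S.MQinv T ω μ α x₀ u w).get hw
      = hgk.toLp (fun t => g t - k t) - mulOp T ω (S.Jd - α • S.R + μ • P) (v - w) := by
    rw [hgv, hkv, map_sub, show hgk.toLp (fun t => g t - k t) = hg.toLp g - hk.toLp k
      from MemLp.toLp_sub hg hk]
    abel
  have e1 : inner ℝ (hgk.toLp (fun t => g t - k t)) (v - w)
      = 1 / 2 * Real.exp (-2 * T * ω) * ‖z T‖ ^ 2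
        + ω * ‖mulOp T ω (psdSqrt P) (v - w)‖ ^ 2 := by
    rw [inner_weightedL2, norm_sq_mulOp]
    refine Eq.trans ?_ (hE.trans ?_)
    · refine integral_congr_ae ?_
      filter_upwards [coeFn_sub_weightedL2 v w,
        ae_weightedMeasure_iff.mp hgk.coeFn_toLp] with t h1 h2
      rw [h1, h2]
    · congr 2
      refine integral_congr_ae ?_
      filter_upwards [coeFn_sub_weightedL2 v w] with t h1
      rw [h1]
      rfl
  have e2 : inner ℝ (mulOp T ω (S.Jd - α • S.R + μ • P) (v - w)) (v - w)
      = -α * ‖mulOp T ω (psdSqrt S.R) (v - w)‖ ^ 2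
        + μ * ‖mulOp T ω (psdSqrt P) (v - w)‖ ^ 2 := by
    have h1 : inner ℝ (mulOp T ω S.Jd (v - w)) (v - w) = 0 := by
      rw [inner_weightedL2]
      refine integral_eq_zero_of_ae ?_
      filter_upwards [coeFn_mulOp S.Jd (v - w)] with t h
      rw [h, inner_mulVecE_self_of_skew hS.transpose_Jd, mul_zero, Pi.zero_apply]
    have h2 : mulOp T ω (S.Jd - α • S.R + μ • P) (v - w)
        = mulOp T ω S.Jd (v - w) - α • mulOp T ω S.R (v - w) + μ • mulOp T ω P (v - w) := by
      refine ext_weightedL2 ?_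
      filter_upwards [coeFn_mulOp (S.Jd - α • S.R + μ • P) (v - w), coeFn_mulOp S.Jd (v - w),
        coeFn_mulOp S.R (v - w), coeFn_mulOp P (v - w),
        ae_weightedMeasure_iff.mp (Lp.coeFn_add
          (mulOp T ω S.Jd (v - w) - α • mulOp T ω S.R (v - w)) (μ • mulOp T ω P (v - w))),
        coeFn_sub_weightedL2 (mulOp T ω S.Jd (v - w)) (α • mulOp T ω S.R (v - w)),
        ae_weightedMeasure_iff.mp (Lp.coeFn_smul α (mulOp T ω S.R (v - w))),
        ae_weightedMeasure_iff.mp (Lp.coeFn_smul μ (mulOp T ω P (v - w)))]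
        with t a1 a2 a3 a4 a5 a6 a7 a8
      rw [a5, Pi.add_apply, a6, a7, a8, Pi.smul_apply, Pi.smul_apply, a1, a2, a3, a4]
      simp only [mulVecE, map_add, map_sub, map_smul, LinearMap.add_apply, LinearMap.sub_apply,
        LinearMap.smul_apply]
    rw [h2, inner_add_left, inner_sub_left, real_inner_smul_left, real_inner_smul_left, h1,
      inner_mulOp_self_of_posSemidef hS.posSemidef_R, inner_mulOp_self_of_posSemidef hP]
    ring
  rw [e0, inner_sub_left, e1, e2]
  ring

/-- Surjectivity of `I + l M Q⁻¹`. -/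
theorem IsCoupledPHDAE.exists_add_smul_MQinv_eq (hS : S.IsCoupledPHDAE T x₀ u) (hα : 0 ≤ α)
    {l : ℝ} (hl : 0 < l) (y : WeightedL2 T ω (StateIdx n)) :
    ∃ (v : WeightedL2 T ω (StateIdx n)) (hv : (S.MQinv T ω μ α x₀ u v).Dom),
      v + l • (S.MQinv T ω μ α x₀ u v).get hv = y := by
  have hP := hS.posSemidef_E_mul_Q_inv
  have hPQ : mulVecE S.E x₀ = mulVecE (S.E * S.Q⁻¹) (mulVecE S.Q x₀) := by
    rw [← mulVecE_mul, Matrix.mul_assoc, Matrix.nonsing_inv_mul _ hS.isUnit_Q, Matrix.mul_one]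
  set N := S.Jd - α • S.R + μ • (S.E * S.Q⁻¹) with hN
  set b := mulOp T ω S.B ((memLp_weighted ω (Lp.memLp u)).toLp u) with hb
  -- Division of `v + l ((P v)' - N v - b) = y` by `l` gives `(P v)' + K v = l⁻¹ y + b`.
  let K := LinearMap.toContinuousLinearMap (Matrix.toEuclideanLin (l⁻¹ • 1 - N))
  have hKapp : ∀ x, K x = l⁻¹ • x - mulVecE N x := by
    intro x
    change Matrix.toEuclideanLin (l⁻¹ • 1 - N) x = _
    rw [map_sub, map_smul, LinearMap.sub_apply, LinearMap.smul_apply]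
    congr 2
    simp
  -- The term `μ P` vanishes on `ker P`, so `l` need not be small compared with `1/μ`.
  have hK : ∀ x, LinearMap.toContinuousLinearMap (Matrix.toEuclideanLin (S.E * S.Q⁻¹)) x = 0 →
      inner ℝ x (K x) = 0 → x = 0 := by
    intro x hPx hx
    have hPx' : mulVecE (S.E * S.Q⁻¹) x = 0 := hPx
    have hNx : mulVecE N x = mulVecE S.Jd x - α • mulVecE S.R x := by
      have : mulVecE N x
          = mulVecE S.Jd x - α • mulVecE S.R x + μ • mulVecE (S.E * S.Q⁻¹) x := by
        simp only [hN, mulVecE, map_add, map_sub, map_smul, LinearMap.add_apply,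
          LinearMap.sub_apply, LinearMap.smul_apply]
      rw [this, hPx', smul_zero, add_zero]
    rw [hKapp, hNx, inner_sub_right, inner_sub_right, real_inner_smul_right, real_inner_smul_right,
      real_inner_comm, real_inner_comm (mulVecE S.Jd x), real_inner_comm (mulVecE S.R x),
      inner_mulVecE_self_of_skew hS.transpose_Jd, inner_mulVecE_self_of_posSemidef hS.posSemidef_R,
      real_inner_self_eq_norm_sq] at hx
    have h1 : 0 ≤ α * ‖mulVecE (psdSqrt S.R) x‖ ^ 2 := by positivity
    have h2 : l⁻¹ * ‖x‖ ^ 2 ≤ 0 := by linarith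
    by_contra hne
    have h3 : 0 < l⁻¹ * ‖x‖ ^ 2 := by
      have := norm_pos_iff.mpr hne
      positivity
    linarith
  obtain ⟨v, g, hvL, hvg, hv0, hvK⟩ := exists_solution_dae hS.T_pos.le
    (LinearMap.toContinuousLinearMap (Matrix.toEuclideanLin (S.E * S.Q⁻¹))) K
    (isSymmetric_mulVecE hP) hK (memLp_of_weighted (Lp.memLp (l⁻¹ • y + b))) (mulVecE S.Q x₀)
  let V : WeightedL2 T ω (StateIdx n) := (memLp_weighted ω hvL).toLp v
  have hVv : ∀ᵐ t ∂volume.restrict (Icc 0 T), V t = v t :=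
    ae_weightedMeasure_iff.mp (memLp_weighted ω hvL).coeFn_toLp
  have hPV : (fun t => mulVecE (S.E * S.Q⁻¹) (v t))
      =ᵐ[volume.restrict (Icc 0 T)] fun t => mulVecE (S.E * S.Q⁻¹) (V t) := by
    filter_upwards [hVv] with t h
    rw [h]
  have hVg : HasWeakDeriv T (fun t => mulVecE (S.E * S.Q⁻¹) (V t)) g :=
    hvg.congr_ae hPV Filter.EventuallyEq.rfl
  have hV0 : HasValueAt T (fun t => mulVecE (S.E * S.Q⁻¹) (V t)) 0 (mulVecE S.E x₀) := by
    rw [hPQ]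
    exact HasValueAt.congr_ae hv0 hPV
  have hdom := dom_MQinv_of_hasWeakDeriv (u := u) ω μ α hVg hV0
  refine ⟨V, hdom, ?_⟩
  obtain ⟨k, hk, hkw, -, hkv⟩ := hS.exists_get_MQinv_eq ω μ α hdom
  -- The weak derivative `k` in the operator comes from a choice and agrees with the constructed `g`
  -- only almost everywhere, by uniqueness.
  have key : hk.toLp k + (l⁻¹ • V - mulOp T ω N V) = l⁻¹ • y + b := by
    refine ext_weightedL2 ?_
    filter_upwards [hvK, hVv, hkw.unique hVg, ae_weightedMeasure_iff.mp hk.coeFn_toLp,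
      ae_weightedMeasure_iff.mp (Lp.coeFn_add (hk.toLp k) (l⁻¹ • V - mulOp T ω N V)),
      coeFn_sub_weightedL2 (l⁻¹ • V) (mulOp T ω N V),
      ae_weightedMeasure_iff.mp (Lp.coeFn_smul l⁻¹ V), coeFn_mulOp N V]
      with t a1 a2 a3 a4 a5 a6 a7 a8
    rw [a5, Pi.add_apply, a6, a7, Pi.smul_apply, a8, a4, a3, a2, ← a1, hKapp]
  rw [hkv]
  have e : hk.toLp k - mulOp T ω N V - b = l⁻¹ • y - l⁻¹ • V := by
    rw [← sub_eq_zero]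
    rw [← sub_eq_zero] at key
    rw [← key]
    abel
  rw [e, smul_sub, smul_smul, smul_smul, mul_inv_cancel₀ hl.ne', one_smul, one_smul]
  abel

end CoupledSystem

end PHDAE

theorem lemma1 {s : ℕ} (n : Fin s → ℕ) (m : ℕ) (S : PHDAE.CoupledSystem n m) (T ω μ α : ℝ)
    (x₀ : EuclideanSpace ℝ (PHDAE.StateIdx n))
    (u : Lp (EuclideanSpace ℝ (Fin m)) 2 (volume.restrict (Icc 0 T)))
    (hS : S.IsCoupledPHDAE T x₀ u) (hμ : 0 ≤ μ) (hμω : μ ≤ ω) (hα : α ∈ Icc (0 : ℝ) 1) :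
    PHDAE.IsMaximallyMonotone (S.MQinv T ω μ α x₀ u) ∧
    (∀ (v w : PHDAE.WeightedL2 T ω (PHDAE.StateIdx n))
      (hv : (S.MQinv T ω μ α x₀ u v).Dom) (hw : (S.MQinv T ω μ α x₀ u w).Dom),
      ∃ z : ℝ → EuclideanSpace ℝ (PHDAE.StateIdx n),
        PHDAE.IsContRep T
          (fun t => PHDAE.mulVecE (PHDAE.psdSqrt (S.E * S.Q⁻¹)) (v t - w t)) z ∧
        inner ℝ ((S.MQinv T ω μ α x₀ u v).get hv - (S.MQinv T ω μ α x₀ u w).get hw) (v - w)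
          = 1 / 2 * Real.exp (-2 * T * ω) * ‖z T‖ ^ 2
            + (ω - μ) * ‖PHDAE.mulOp T ω (PHDAE.psdSqrt (S.E * S.Q⁻¹)) (v - w)‖ ^ 2
            + α * ‖PHDAE.mulOp T ω (PHDAE.psdSqrt S.R) (v - w)‖ ^ 2 ∧
        0 ≤ 1 / 2 * Real.exp (-2 * T * ω) * ‖z T‖ ^ 2
            + (ω - μ) * ‖PHDAE.mulOp T ω (PHDAE.psdSqrt (S.E * S.Q⁻¹)) (v - w)‖ ^ 2
            + α * ‖PHDAE.mulOp T ω (PHDAE.psdSqrt S.R) (v - w)‖ ^ 2) ∧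
    ∀ l : ℝ, 0 < l → ∀ y : PHDAE.WeightedL2 T ω (PHDAE.StateIdx n),
      ∃ (v : PHDAE.WeightedL2 T ω (PHDAE.StateIdx n)) (hv : (S.MQinv T ω μ α x₀ u v).Dom),
        v + l • (S.MQinv T ω μ α x₀ u v).get hv = y := by
  have hsurj := fun (l : ℝ) (hl : 0 < l) => hS.exists_add_smul_MQinv_eq ω μ α hα.1 hl
  have hnonneg : ∀ a b c : ℝ, 0 ≤ 1 / 2 * Real.exp (-2 * T * ω) * a ^ 2
      + (ω - μ) * b ^ 2 + α * c ^ 2 := by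
    intro a b c
    have h1 : 0 ≤ ω - μ := sub_nonneg.mpr hμω
    have h2 : 0 ≤ α := hα.1
    positivity
  refine ⟨PHDAE.isMaximallyMonotone_of_surjective ?_ ?_, ?_, hsurj⟩
  · rintro ⟨v, a⟩ hva ⟨w, b⟩ hwb
    obtain ⟨hv, rfl⟩ : a ∈ S.MQinv T ω μ α x₀ u v := hva
    obtain ⟨hw, rfl⟩ : b ∈ S.MQinv T ω μ α x₀ u w := hwb
    obtain ⟨z, -, hz⟩ := hS.inner_MQinv_sub ω μ α hv hw
    rw [real_inner_comm, hz]
    exact hnonneg _ _ _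
  · intro y
    obtain ⟨v, hv, h⟩ := hsurj 1 one_pos y
    exact ⟨v, hv, by rwa [one_smul] at h⟩
  · intro v w hv hw
    obtain ⟨z, hz, h⟩ := hS.inner_MQinv_sub ω μ α hv hw
    exact ⟨z, hz, h, hnonneg _ _ _⟩
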